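/- Let $\Sigma$ be a general ordered alphabet of size $\sigma\ge 2$ and let $T\in\Sigma^*$ be a text of length $n$ that ends with a character $\$$ which appears nowhere else in $T$. (The empty string occurs at all $n+1$ positions of $T$.) A *maximal repeat* of $T$ is a string $w$ that occurs more than once in $T$ such that all strings $aw$ and $wa$ ($a\in\Sigma$) occur strictly fewer times than $w$. Let $e^r_T$ (resp. $e^\ell_T$) be the number of substrings of $T$ of the form $wa$ (resp. $aw$) with $w$ a maximal repeat and $a\in\Sigma$, and let $\tilde e_T=e^r_T+e^\ell_T$. For a substring $x$ of $T$ let $\overrightarrow{x}$ be the longest string with the same beginning positions in $T$ as $x$, and let $[x]$ be the set of all strings with the same ending positions in $T$ as $x$. The nodes of $\mathrm{CDAWG}(T)$ (*type-1 nodes*) are the classes $[\overrightarrow{x}]$, $x$ a substring of $T$. For each substring $x=\overrightarrow{x}$ and each letter $a$ such that $xa$ is a substring of $T$ there is an edge $([x],\alpha,[x\alpha])$ with label $\alpha$ given by $x\alpha=\overrightarrow{xa}$. The source is $[\varepsilon]$. The value of a node is its longest member, and the suffix link of a node $v$ other than the source is the node $[y]$ of the longest suffix $y$ of the value of $v$ with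 $y\notin v$. The L-CDAWG of $T$ has, in addition, the following *type-2 nodes*: for each type-1 node with value $u$ and each letter $a$ such that $au$ is a substring of $T$ and the path that spells $au$ from the source of $\mathrm{CDAWG}(T)$ ends in the middle of an edge, there is a type-2 node at this place of the edge, and its suffix link is the type-1 node with value $u$. Let $\mathrm{CDAWG}(T)$ be given in the memory of a unit-cost word RAM: numbered nodes with suffix links; for each node the array of its outgoing edges, sorted by the first characters of the labels; for each edge its two end points and a pair of positions that describes its label as a substring of $T$. Characters of $T$ are accessed only through $O(1)$-time comparisons of the characters at two positions of $T$. Let $N$ be the length of $T$ plus the number of words of the representation of the graph. **Lemma.** There are a fixed RAM program and constants $c, C$, independent of $\Sigma$ and $T$, such that for each such $T$, each such representation of $\mathrm{CDAWG}(T)$ and each word bound $W\ge N^c$ (all words are in $\{0,\dots,W-1\}$, so $O(\log N)$ bits suffice) the program computes all type-2 nodes of the L-CDAWG of $T$ in at most $C\,\tilde e_T\log_2\sigma$ steps: it leaves the given representation unchanged and outputs the list in which each type-2 node appears exactly once, as a triple (edge of $\mathrm{CDAWG}(T)$, offset in the label of that edge, suffix link), ordered by edges and, on each edge, by offsets. 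-/

import Mathlib

namespace LCDAWG

universe u

section Strings

variable {A : Type u}

/-- Beginning positions (counted from `0`) of the occurrences of `x` in `T`.
The empty string occurs at every position `0, …, |T|`. -/
def begPos (T x : List A) : Set ℕ :=
  {i | ∃ p s, T = p ++ x ++ s ∧ i = p.length}

/-- Ending positions of the occurrences of `x` in `T` (position after the last character). -/
def endPos (T x : List A) : Set ℕ :=
  {j | ∃ p s, T = p ++ x ++ s ∧ j = (p ++ x).length}

/-- The number of occurrences of `x` in `T`. -/
noncomputable def occ (T x : List A) : ℕ := (begPos T x).ncard

/-- `w` is a maximal repeat of `T`: it occurs more than once, and all its left and right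
extensions occur strictly fewer times. -/
def IsMaximalRepeat (T w : List A) : Prop :=
  1 < occ T w ∧ (∀ a : A, occ T (a :: w) < occ T w) ∧ (∀ a : A, occ T (w ++ [a]) < occ T w)

/-- The right extensions `wa` (occurring in `T`) of the maximal repeats `w` of `T`. -/
def rightExtensions (T : List A) : Set (List A) :=
  {y | ∃ (w : List A) (a : A), IsMaximalRepeat T w ∧ y = w ++ [a] ∧ y <:+: T}

/-- The left extensions `aw` (occurring in `T`) of the maximal repeats `w` of `T`. -/
def leftExtensions (T : List A) : Set (List A) :=
  {y | ∃ (w : List A) (a : A), IsMaximalRepeat T w ∧ y = a :: w ∧ y <:+: T}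

/-- The number of right extensions plus the number of left extensions of maximal repeats. -/
noncomputable def numExtensions (T : List A) : ℕ :=
  (rightExtensions T).ncard + (leftExtensions T).ncard

/-- `T` ends with a character that appears nowhere else in `T`. -/
def EndMarked (T : List A) : Prop :=
  ∃ (S : List A) (d : A), T = S ++ [d] ∧ d ∉ S

end Strings

section Graph

variable {A : Type u}

/-- `y` is the longest string with the same beginning positions in `T` as `x`. -/
def IsLongestRight (T x y : List A) : Prop :=
  begPos T y = begPos T x ∧ ∀ z, begPos T z = begPos T x → z.length ≤ y.length

/-- The class of all strings with the same ending positions in `T` as `x`. -/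
def endClass (T x : List A) : Set (List A) := {z | endPos T z = endPos T x}

/-- The nodes of the CDAWG of `T` (the type-1 nodes): the ending-position classes of the strings
`y` that are the longest in the beginning-position class of a substring `x` of `T`. -/
def nodes (T : List A) : Set (Set (List A)) :=
  {v | ∃ x y, x <:+: T ∧ IsLongestRight T x y ∧ v = endClass T y}

/-- The source of the CDAWG. -/
def source (T : List A) : Set (List A) := endClass T []

/-- The value of a node: its longest member. -/
def IsValue (v : Set (List A)) (w : List A) : Prop :=
  w ∈ v ∧ ∀ z ∈ v, z.length ≤ w.length

/-- A directed edge between two nodes, labelled by a string. -/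
@[ext] structure Edge (A : Type u) where
  hi : Set (List A)
  lab : List A
  lo : Set (List A)

/-- The edges of the CDAWG of `T`. For a substring `x` that is the longest in its
beginning-position class, and a letter `a` such that `xa` is a substring, there is one edge: it
leaves the node of `x`, its label is the `α` for which `xα` is the longest string with the
beginning positions of `xa`, and it enters the node of `xα`. -/
def edges (T : List A) : Set (Edge A) :=
  {f | ∃ (x : List A) (a : A), x <:+: T ∧ IsLongestRight T x x ∧ (x ++ [a]) <:+: T ∧
    IsLongestRight T (x ++ [a]) (x ++ f.lab) ∧
    f.hi = endClass T x ∧ f.lo = endClass T (x ++ f.lab)}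

/-- `u` is the suffix link of `v`: the node of the longest suffix of the value of `v` that does
not belong to `v`. -/
def IsSuffixLink (T : List A) (v u : Set (List A)) : Prop :=
  v ∈ nodes T ∧ ∃ w y, IsValue v w ∧ y <:+ w ∧ y ∉ v ∧
    (∀ z, z <:+ w → z ∉ v → z.length ≤ y.length) ∧ u = endClass T y

/-- `PathSpells T u w v`: there is a path of the CDAWG of `T` from `u` to `v` that spells `w`. -/
inductive PathSpells (T : List A) : Set (List A) → List A → Set (List A) → Prop
  | nil (u : Set (List A)) : PathSpells T u [] u
  | snoc {u : Set (List A)} {w : List A} {f : Edge A} :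
      PathSpells T u w f.hi → f ∈ edges T → PathSpells T u (w ++ f.lab) f.lo

/-- The path that spells `w` from the source ends in the middle of the edge `f`, namely after `k`
characters of its label. -/
def EndsInside (T w : List A) (f : Edge A) (k : ℕ) : Prop :=
  f ∈ edges T ∧ 0 < k ∧ k < f.lab.length ∧
    ∃ w', PathSpells T (source T) w' f.hi ∧ w = w' ++ f.lab.take k

/-- The Linear-size CDAWG of `T` has a type-2 node on the edge `f`, after `k` characters of its
label, and the suffix link of this type-2 node is the type-1 node `u`. -/
def IsType2Node (T : List A) (f : Edge A) (k : ℕ) (u : Set (List A)) : Prop :=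
  u ∈ nodes T ∧ ∃ (w : List A) (a : A), IsValue u w ∧ (a :: w) <:+: T ∧ EndsInside T (a :: w) f k

end Graph

section Machine

/-- The operations on words. -/
inductive Op
  | add | sub | mul | div | lt

/-- Expressions of a random access machine: constants, registers, memory cells, operations on
words, and the test whether the text character at one position is smaller than that at another
position. (This comparison is the only access to the characters.) -/
inductive RExpr
  | const (k : ℕ)
  | reg (i : ℕ)
  | mem (addr : RExpr)
  | op (o : Op) (l r : RExpr)
  | charLt (l r : RExpr)

/-- Structured programs of the random access machine. -/
inductive Prog
  | skip
  | assign (i : ℕ) (e : RExpr)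
  | store (addr e : RExpr)
  | seq (p q : Prog)
  | ite (e : RExpr) (p q : Prog)
  | loop (e : RExpr) (p : Prog)

/-- Contents of the registers and of the memory. -/
structure Config where
  reg : ℕ → ℕ
  mem : ℕ → ℕ

/-- The value of an operation; subtraction is truncated, `x / 0 = 0`, and a comparison gives
`1` or `0`. -/
def Op.apply : Op → ℕ → ℕ → ℕ
  | .add, x, y => x + y
  | .sub, x, y => x - y
  | .mul, x, y => x * y
  | .div, x, y => x / y
  | .lt, x, y => if x < y then 1 else 0

/-- The number of steps for the evaluation of an expression: one for each node of it. -/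
def RExpr.cost : RExpr → ℕ
  | .const _ => 1
  | .reg _ => 1
  | .mem e => e.cost + 1
  | .op _ l r => l.cost + r.cost + 1
  | .charLt l r => l.cost + r.cost + 1

variable {A : Type u} [LinearOrder A]

/-- Evaluation of an expression with machine words in `{0, …, W - 1}`. There is no result if a
number does not fit into a machine word, or if a text position is out of range. -/
def RExpr.value (W : ℕ) (T : List A) (s : Config) : RExpr → Option ℕ
  | .const k => if k < W then some k else none
  | .reg i => some (s.reg i)
  | .mem e => (e.value W T s).map s.mem
  | .op o l r =>
    match l.value W T s, r.value W T s with
    | some x, some y => if o.apply x y < W then some (o.apply x y) else none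
    | _, _ => none
  | .charLt l r =>
    match l.value W T s, r.value W T s with
    | some x, some y =>
      match T[x]?, T[y]? with
      | some c, some d => some (if c < d then 1 else 0)
      | _, _ => none
    | _, _ => none

/-- `Exec W T p s t s'`: with word bound `W` and text `T`, the program `p` started in the
configuration `s` halts after exactly `t` steps in the configuration `s'`. -/
inductive Exec (W : ℕ) (T : List A) : Prog → Config → ℕ → Config → Prop
  | skip (s : Config) : Exec W T .skip s 1 s
  | assign {s : Config} {i : ℕ} {e : RExpr} {x : ℕ} :
      e.value W T s = some x →
      Exec W T (.assign i e) s (e.cost + 1) ⟨Function.update s.reg i x, s.mem⟩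
  | store {s : Config} {d e : RExpr} {a x : ℕ} :
      d.value W T s = some a → e.value W T s = some x →
      Exec W T (.store d e) s (d.cost + e.cost + 1) ⟨s.reg, Function.update s.mem a x⟩
  | seq {s s₁ s₂ : Config} {p q : Prog} {t₁ t₂ : ℕ} :
      Exec W T p s t₁ s₁ → Exec W T q s₁ t₂ s₂ → Exec W T (.seq p q) s (t₁ + t₂) s₂
  | ite_true {s s' : Config} {e : RExpr} {p q : Prog} {x t : ℕ} :
      e.value W T s = some x → x ≠ 0 → Exec W T p s t s' →
      Exec W T (.ite e p q) s (e.cost + 1 + t) s'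
  | ite_false {s s' : Config} {e : RExpr} {p q : Prog} {t : ℕ} :
      e.value W T s = some 0 → Exec W T q s t s' →
      Exec W T (.ite e p q) s (e.cost + 1 + t) s'
  | loop_true {s s₁ s₂ : Config} {e : RExpr} {p : Prog} {x t₁ t₂ : ℕ} :
      e.value W T s = some x → x ≠ 0 → Exec W T p s t₁ s₁ → Exec W T (.loop e p) s₁ t₂ s₂ →
      Exec W T (.loop e p) s (e.cost + 1 + t₁ + t₂) s₂
  | loop_false {s : Config} {e : RExpr} {p : Prog} :
      e.value W T s = some 0 → Exec W T (.loop e p) s (e.cost + 1) s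

end Machine

section Representation

variable {A : Type u} [LinearOrder A]

/-- A representation of the CDAWG of `T`: the nodes and the edges are numbered, the edges that
leave a node are consecutive and sorted by the first characters of their labels, each label is
given by an occurrence in `T`, and each node has a link to its suffix link (for the source, which
has no suffix link, this link is arbitrary). -/
structure CdawgRep (T : List A) where
  numNodes : ℕ
  numEdges : ℕ
  node : Fin numNodes → Set (List A)
  node_injective : Function.Injective node
  range_node : Set.range node = nodes T
  edge : Fin numEdges → Edge A
  edge_injective : Function.Injective edge
  range_edge : Set.range edge = edges T
  root : Fin numNodes
  node_root : node root = source T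
  slink : Fin numNodes → Fin numNodes
  slink_spec : ∀ v, v ≠ root → IsSuffixLink T (node v) (node (slink v))
  hi : Fin numEdges → Fin numNodes
  node_hi : ∀ e, node (hi e) = (edge e).hi
  lo : Fin numEdges → Fin numNodes
  node_lo : ∀ e, node (lo e) = (edge e).lo
  labBeg : Fin numEdges → ℕ
  labBeg_mem : ∀ e, labBeg e ∈ begPos T (edge e).lab
  outBeg : Fin numNodes → ℕ
  outEnd : Fin numNodes → ℕ
  out_le : ∀ v, outBeg v ≤ outEnd v ∧ outEnd v ≤ numEdges
  mem_out : ∀ v e, hi e = v ↔ outBeg v ≤ e.val ∧ e.val < outEnd v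
  sorted : ∀ e e', hi e = hi e' → e < e' →
    ∀ a ∈ (edge e).lab.head?, ∀ b ∈ (edge e').lab.head?, a < b

/-- The number of memory cells of a representation (the text is not counted). -/
def CdawgRep.cells {T : List A} (R : CdawgRep T) : ℕ := 4 + 3 * R.numNodes + 4 * R.numEdges

/-- The input size: the length of the text plus the number of memory cells. -/
def CdawgRep.size {T : List A} (R : CdawgRep T) : ℕ := T.length + R.cells

/-- The memory `m` holds the representation `R`: a header, then three cells for each node, then
four cells for each edge. All further cells are `0`. -/
structure CdawgRep.Loaded {T : List A} (R : CdawgRep T) (m : ℕ → ℕ) : Prop where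
  length : m 0 = T.length
  numNodes : m 1 = R.numNodes
  numEdges : m 2 = R.numEdges
  root : m 3 = R.root
  slink : ∀ v, m (4 + 3 * v.val) = R.slink v
  outBeg : ∀ v, m (4 + 3 * v.val + 1) = R.outBeg v
  outEnd : ∀ v, m (4 + 3 * v.val + 2) = R.outEnd v
  hi : ∀ e, m (4 + 3 * R.numNodes + 4 * e.val) = R.hi e
  labBeg : ∀ e, m (4 + 3 * R.numNodes + 4 * e.val + 1) = R.labBeg e
  labEnd : ∀ e, m (4 + 3 * R.numNodes + 4 * e.val + 2) = R.labBeg e + (R.edge e).lab.length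
  lo : ∀ e, m (4 + 3 * R.numNodes + 4 * e.val + 3) = R.lo e
  rest : ∀ a, R.cells ≤ a → m a = 0

/-- The list `L` contains every type-2 node exactly once, as a triple (edge, offset in the label of
this edge, suffix link); the triples are ordered by edges, and on each edge by offsets. -/
def CdawgRep.ListsType2Nodes {T : List A} (R : CdawgRep T)
    (L : List (Fin R.numEdges × ℕ × Fin R.numNodes)) : Prop :=
  L.Pairwise (fun x y => x.1 < y.1 ∨ (x.1 = y.1 ∧ x.2.1 < y.2.1)) ∧
    ∀ e k v, (e, k, v) ∈ L ↔ IsType2Node T (R.edge e) k (R.node v)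

/-- The configuration `s` holds the list `L` as its output: register `0` contains the address and
register `1` the length of an array of triples. -/
def CdawgRep.HasOutput {T : List A} (R : CdawgRep T) (s : Config)
    (L : List (Fin R.numEdges × ℕ × Fin R.numNodes)) : Prop :=
  s.reg 1 = L.length ∧ ∀ (i : ℕ) (h : i < L.length),
    s.mem (s.reg 0 + 3 * i) = L[i].1 ∧
    s.mem (s.reg 0 + 3 * i + 1) = L[i].2.1 ∧
    s.mem (s.reg 0 + 3 * i + 2) = L[i].2.2

end Representation

end LCDAWG

/-! Let `f` be an edge leaving the node `v`, and let `aw`, with `w` the value of a node, be spelled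
by a path that stops inside `f` after `k` letters of its label. Then `aw` is some `x` in `v`
followed by these `k` letters, and `x` is the shortest member of `v`: otherwise dropping the first
letter of `x` would keep its ending positions, so `aw` and `w` would end at the same positions and
`w` would not be a value. Conversely, if the shortest `x`, extended by `k` letters and deprived of
its first letter, is right-maximal, it is the value of its node, because inside an edge no string is
right-maximal.

Hence the type-2 nodes on `f` are the inner offsets at which the path that starts at the suffix link
of `v` and reads the label of `f` meets a node (`isType2Node_iff`). The shortest member of the
source is empty, so there the path starts at the source after the first letter of the label. The
path can be followed edge by edge, since nothing is met strictly inside an edge (`WalksTo.step`).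

Each jump needs a binary search among at most `σ` outgoing edges. A jump from a positive offset is
charged to the type-2 node found there, a jump from offset `0` to the edge `f`. Edges inject into
right extensions (`edges_ncard_le`) and type-2 nodes into left extensions
(`CdawgRep.pairwise_length_le`), which gives the time bound. Handling edges and offsets in
increasing order makes the output sorted. -/

namespace LCDAWG

universe u

/-! ### Beginning positions, ending positions and right-maximal strings. -/

section Occurrences

variable {A : Type u} {T x y z : List A} {a : A} {i j : ℕ}

theorem mem_begPos : i ∈ begPos T x ↔ i ≤ T.length ∧ x <+: T.drop i := by
  constructor
  · rintro ⟨p, s, rfl, rfl⟩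
    simp
  · rintro ⟨hi, s, hs⟩
    refine ⟨T.take i, s, ?_, ?_⟩
    · rw [List.append_assoc, hs, List.take_append_drop]
    · simp [hi]

theorem mem_endPos : j ∈ endPos T x ↔ j ≤ T.length ∧ x <:+ T.take j := by
  constructor
  · rintro ⟨p, s, rfl, rfl⟩
    exact ⟨by simp, by rw [List.take_left]; exact List.suffix_append _ _⟩
  · rintro ⟨hj, p, hp⟩
    refine ⟨p, T.drop j, ?_, ?_⟩
    · rw [hp, List.take_append_drop]
    · rw [hp]; simp [hj]

theorem add_mem_endPos : i + x.length ∈ endPos T x ↔ i ∈ begPos T x := by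
  constructor
  · rintro ⟨p, s, h, h'⟩
    exact ⟨p, s, h, by simp at h'; omega⟩
  · rintro ⟨p, s, h, rfl⟩
    exact ⟨p, s, h, by simp⟩

theorem length_le_of_mem_endPos (h : j ∈ endPos T x) : x.length ≤ j := by
  obtain ⟨p, s, -, rfl⟩ := h
  simp

theorem endPos_eq_image : endPos T x = (fun i => i + x.length) '' begPos T x := by
  ext j
  constructor
  · intro h
    have := length_le_of_mem_endPos h
    exact ⟨j - x.length, add_mem_endPos.1 (by rwa [Nat.sub_add_cancel this]),
      Nat.sub_add_cancel this⟩
  · rintro ⟨i, hi, rfl⟩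
    exact add_mem_endPos.2 hi

theorem begPos_finite : (begPos T x).Finite :=
  (Set.finite_Iic T.length).subset fun _ h => (mem_begPos.1 h).1

theorem endPos_finite : (endPos T x).Finite :=
  (Set.finite_Iic T.length).subset fun _ h => (mem_endPos.1 h).1

theorem occ_eq_ncard_endPos : occ T x = (endPos T x).ncard := by
  rw [endPos_eq_image, Set.ncard_image_of_injective _ (add_left_injective _), occ]

theorem endPos_nonempty : (endPos T x).Nonempty ↔ x <:+: T := by
  constructor
  · rintro ⟨j, p, s, h, -⟩
    exact ⟨p, s, h.symm⟩
  · rintro ⟨p, s, h⟩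
    exact ⟨_, p, s, h.symm, rfl⟩

theorem begPos_nonempty : (begPos T x).Nonempty ↔ x <:+: T := by
  rw [← endPos_nonempty, endPos_eq_image, Set.image_nonempty]

theorem endPos_subset_of_suffix (h : y <:+ x) : endPos T x ⊆ endPos T y := fun _ hj =>
  mem_endPos.2 ⟨(mem_endPos.1 hj).1, h.trans (mem_endPos.1 hj).2⟩

theorem begPos_subset_of_prefix (h : y <+: x) : begPos T x ⊆ begPos T y := fun _ hj =>
  mem_begPos.2 ⟨(mem_begPos.1 hj).1, h.trans (mem_begPos.1 hj).2⟩

theorem mem_endPos_append :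
    j ∈ endPos T (x ++ y) ↔ ∃ i, j = i + y.length ∧ i ∈ endPos T x ∧ i ∈ begPos T y := by
  constructor
  · rintro ⟨p, s, h, rfl⟩
    refine ⟨(p ++ x).length, by simp; omega, ⟨p, y ++ s, by simp [h], rfl⟩,
      ⟨p ++ x, s, by simp [h], rfl⟩⟩
  · rintro ⟨i, rfl, ⟨p, s, h, rfl⟩, ⟨p', s', h', h''⟩⟩
    have h1 : p ++ x = p' ++ [] ∧ s = y ++ s' := by
      have := List.append_inj (h.symm.trans (h'.trans (List.append_assoc _ _ _))) h''
      simpa using this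
    exact ⟨p, s', by rw [h, h1.2]; simp, by simp; omega⟩

theorem mem_begPos_append :
    i ∈ begPos T (x ++ y) ↔ i + x.length ∈ endPos T x ∧ i + x.length ∈ begPos T y := by
  rw [← add_mem_endPos, mem_endPos_append]
  constructor
  · rintro ⟨j, hj, h⟩
    obtain rfl : j = i + x.length := by simp at hj; omega
    exact h
  · exact fun h => ⟨_, by simp; omega, h⟩

/-- Only the ending positions of `x` matter on the right-hand side. This is why the label of an edge
does not depend on the member of the node that is chosen. -/
theorem begPos_append_eq_iff {l l' : List A} : begPos T (x ++ l) = begPos T (x ++ l') ↔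
    ∀ j ∈ endPos T x, (j ∈ begPos T l ↔ j ∈ begPos T l') := by
  constructor
  · intro h j hj
    obtain ⟨i, rfl⟩ := Nat.exists_eq_add_of_le' (length_le_of_mem_endPos hj)
    have := Set.ext_iff.1 h i
    simpa only [mem_begPos_append, hj, true_and] using this
  · intro h
    ext i
    simp only [mem_begPos_append]
    exact and_congr_right (h _)

theorem begPos_append_eq_congr (h : endPos T x = endPos T y) (l l' : List A) :
    begPos T (x ++ l) = begPos T (x ++ l') ↔ begPos T (y ++ l) = begPos T (y ++ l') := by
  rw [begPos_append_eq_iff, begPos_append_eq_iff, h]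

theorem endPos_append_congr (h : endPos T x = endPos T y) (z : List A) :
    endPos T (x ++ z) = endPos T (y ++ z) := by
  ext j
  simp only [mem_endPos_append, h]

theorem infix_congr (h : endPos T x = endPos T y) (hx : x <:+: T) : y <:+: T := by
  rw [← endPos_nonempty] at hx ⊢
  rwa [← h]

/-- Both strings are suffixes of the same prefix of `T`, cut at a common ending position. -/
theorem suffix_of_endPos_eq (hx : x <:+: T) (h : endPos T x = endPos T y)
    (hl : x.length ≤ y.length) : x <:+ y := by
  obtain ⟨j, hj⟩ := endPos_nonempty.2 hx
  exact List.suffix_of_suffix_length_le (mem_endPos.1 hj).2 (mem_endPos.1 (h ▸ hj)).2 hl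

theorem prefix_of_begPos_eq (hx : x <:+: T) (h : begPos T x = begPos T y)
    (hl : x.length ≤ y.length) : x <+: y := by
  obtain ⟨j, hj⟩ := begPos_nonempty.2 hx
  exact List.prefix_of_prefix_length_le (mem_begPos.1 hj).2 (mem_begPos.1 (h ▸ hj)).2 hl

/-- Ending positions shrink as a string grows to the left, so each class is an interval in the
suffix order. -/
theorem endPos_eq_of_suffix_suffix (h : endPos T x = endPos T z) (hxy : x <:+ y) (hyz : y <:+ z) :
    endPos T y = endPos T x :=
  (endPos_subset_of_suffix hxy).antisymm (h.trans_subset (endPos_subset_of_suffix hyz))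

theorem begPos_eq_of_prefix_prefix (h : begPos T x = begPos T z) (hxy : x <+: y) (hyz : y <+: z) :
    begPos T y = begPos T x :=
  (begPos_subset_of_prefix hxy).antisymm (h.trans_subset (begPos_subset_of_prefix hyz))

theorem mem_begPos_singleton : i ∈ begPos T [a] ↔ T[i]? = some a := by
  rw [mem_begPos]
  constructor
  · rintro ⟨-, s, hs⟩
    have : (T.drop i)[0]? = some a := by rw [← hs]; simp
    simpa using this
  · intro h
    obtain ⟨hi, rfl⟩ := List.getElem?_eq_some_iff.1 h
    exact ⟨hi.le, _, (List.drop_eq_getElem_cons hi).symm⟩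

/-- All occurrences of `x` in `T` are followed by the letter `a`. -/
def Followed (T x : List A) (a : A) : Prop := ∀ j ∈ endPos T x, T[j]? = some a

theorem begPos_snoc_eq_iff : begPos T (x ++ [a]) = begPos T x ↔ Followed T x a := by
  constructor
  · intro h j hj
    have hl := length_le_of_mem_endPos hj
    rw [← Nat.sub_add_cancel hl, add_mem_endPos, ← h, ← add_mem_endPos, mem_endPos_append] at hj
    obtain ⟨i, hi, -, h2⟩ := hj
    have : i = j := by simp at hi; omega
    rw [← this]
    exact mem_begPos_singleton.1 h2
  · intro h
    refine (begPos_subset_of_prefix (List.prefix_append _ _)).antisymm fun i hi => ?_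
    rw [← add_mem_endPos] at hi ⊢
    exact mem_endPos_append.2 ⟨_, by simp; omega, hi, mem_begPos_singleton.2 (h _ hi)⟩

/-- `x` occurs in `T`, and its occurrences are not all followed by the same letter. -/
def RightMaximal (T x : List A) : Prop := x <:+: T ∧ ∀ a, ¬ Followed T x a

theorem RightMaximal.congr (hx : RightMaximal T x) (h : endPos T x = endPos T y) :
    RightMaximal T y :=
  ⟨infix_congr h hx.1, fun a ha => hx.2 a fun j hj => ha j (h ▸ hj)⟩

/-- A longer string with the same beginnings extends `x`, and its first extra letter follows every
occurrence of `x`. -/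
theorem rightMaximal_iff (hx : x <:+: T) : RightMaximal T x ↔ IsLongestRight T x x := by
  constructor
  · refine fun h => ⟨rfl, fun z hz => ?_⟩
    by_contra! hlt
    obtain ⟨s, rfl⟩ := prefix_of_begPos_eq hx hz.symm hlt.le
    obtain _ | ⟨a, s⟩ := s
    · simp at hlt
    · exact h.2 a (begPos_snoc_eq_iff.1
        (begPos_eq_of_prefix_prefix hz.symm (List.prefix_append _ _) ⟨s, by simp⟩))
  · refine fun h => ⟨hx, fun a ha => ?_⟩
    have := h.2 _ (begPos_snoc_eq_iff.2 ha)
    simp at this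

theorem IsLongestRight.spec (h : IsLongestRight T x y) (hx : x <:+: T) :
    x <+: y ∧ RightMaximal T y := by
  have hy : y <:+: T := begPos_nonempty.1 (h.1 ▸ begPos_nonempty.2 hx)
  exact ⟨prefix_of_begPos_eq hx h.1.symm (h.2 _ rfl),
    (rightMaximal_iff hy).2 ⟨rfl, fun z hz => h.2 z (hz.trans h.1)⟩⟩

theorem exists_isLongestRight (hx : x <:+: T) : ∃ y, IsLongestRight T x y := by
  obtain ⟨i, hi⟩ := begPos_nonempty.2 hx
  have hfin : {z | begPos T z = begPos T x}.Finite := by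
    refine (List.finite_toSet (T.drop i).inits).subset fun z hz => ?_
    exact List.mem_inits _ _ |>.2 (mem_begPos.1 (hz.symm ▸ hi : i ∈ begPos T z)).2
  obtain ⟨y, hy, hm⟩ := Set.exists_max_image _ List.length hfin ⟨x, rfl⟩
  exact ⟨y, hy, hm⟩

theorem rightMaximal_nil : RightMaximal T [] := by
  refine ⟨List.nil_infix, fun a h => ?_⟩
  -- The empty string also occurs at the end of `T`, where no letter follows.
  have := h T.length (mem_endPos.2 ⟨le_rfl, List.nil_suffix⟩)
  simp at this

end Occurrences

/-! ### Nodes, edges and paths of the CDAWG. -/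

section Classes

variable {A : Type u} {T x y z w : List A} {a : A} {v u : Set (List A)} {f : Edge A}

theorem endClass_eq_iff : endClass T x = endClass T y ↔ endPos T x = endPos T y := by
  constructor
  · intro h
    have : x ∈ endClass T x := rfl
    rwa [h] at this
  · intro h
    ext z
    simp [endClass, h]

theorem mem_nodes : v ∈ nodes T ↔ ∃ y, RightMaximal T y ∧ v = endClass T y := by
  constructor
  · rintro ⟨x, y, hx, hy, rfl⟩
    exact ⟨y, (hy.spec hx).2, rfl⟩
  · rintro ⟨y, hy, rfl⟩
    exact ⟨y, y, hy.1, (rightMaximal_iff hy.1).1 hy, rfl⟩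

theorem RightMaximal.of_endClass_mem_nodes (h : endClass T x ∈ nodes T) : RightMaximal T x := by
  obtain ⟨y, hy, h⟩ := mem_nodes.1 h
  exact hy.congr (endClass_eq_iff.1 h).symm

theorem RightMaximal.endClass_mem_nodes (h : RightMaximal T x) : endClass T x ∈ nodes T :=
  mem_nodes.2 ⟨x, h, rfl⟩

theorem endClass_eq_of_mem (hv : v ∈ nodes T) (hx : x ∈ v) : v = endClass T x := by
  obtain ⟨y, -, rfl⟩ := mem_nodes.1 hv
  exact (endClass_eq_iff.2 hx).symm

/-- The properties of an edge, relative to an arbitrary member of the node that it leaves. -/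
theorem edge_spec (hf : f ∈ edges T) (hx : f.hi = endClass T x) :
    RightMaximal T x ∧ f.lab ≠ [] ∧ RightMaximal T (x ++ f.lab) ∧ f.lo = endClass T (x ++ f.lab) ∧
    ∀ k, 0 < k → k ≤ f.lab.length → begPos T (x ++ f.lab.take k) = begPos T (x ++ f.lab) := by
  obtain ⟨y, a, hy, hym, hya, hl, hhi, hlo⟩ := hf
  have hyx : endPos T y = endPos T x := endClass_eq_iff.1 (hhi.symm.trans hx)
  obtain ⟨⟨s, hs⟩, hmax⟩ := hl.spec hya
  have hlab : f.lab = a :: s := by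
    rw [List.append_assoc] at hs
    simpa using (List.append_cancel_left hs).symm
  have hc := endPos_append_congr hyx
  refine ⟨((rightMaximal_iff hy).2 hym).congr hyx, by simp [hlab], hmax.congr (hc _),
    by rw [hlo, endClass_eq_iff, hc], fun k hk hk' => ?_⟩
  have h1 : begPos T (y ++ f.lab.take k) = begPos T (y ++ f.lab) := by
    rw [hl.1]
    refine begPos_eq_of_prefix_prefix hl.1.symm ?_ ?_
    · obtain ⟨k, rfl⟩ := Nat.exists_eq_succ_of_ne_zero hk.ne'
      simp [hlab]
    · exact (List.prefix_append_right_inj _).2 (List.take_prefix _ _)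
  exact (begPos_append_eq_congr hyx _ _).1 h1

theorem exists_edge (hx : RightMaximal T x) (ha : (x ++ [a]) <:+: T) :
    ∃ f ∈ edges T, f.hi = endClass T x ∧ f.lab.head? = some a := by
  obtain ⟨y, hy⟩ := exists_isLongestRight ha
  obtain ⟨s, hs⟩ := (hy.spec ha).1
  refine ⟨⟨endClass T x, a :: s, endClass T (x ++ a :: s)⟩,
    ⟨x, a, hx.1, (rightMaximal_iff hx.1).1 hx, ha, ?_, rfl, rfl⟩, rfl, rfl⟩
  rw [← hs] at hy
  simpa using hy

/-- Once the first letter of the label is read, the rest of the label is forced, in particular the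
next letter. -/
theorem edge_not_rightMaximal (hf : f ∈ edges T) (hx : f.hi = endClass T x) {k : ℕ} (hk : 0 < k)
    (hk' : k < f.lab.length) : ¬ RightMaximal T (x ++ f.lab.take k) := by
  obtain ⟨-, -, -, -, h⟩ := edge_spec hf hx
  intro hm
  refine hm.2 f.lab[k] (begPos_snoc_eq_iff.1 ?_)
  rw [List.append_assoc, List.take_append_getElem, h k hk hk'.le, h (k + 1) (by omega) hk']

/-- An occurrence of `x ++ y` begins with `x` and the first letter of the label (if `y` is read at
all), so `x ++ f.lab` occurs there too. Both are prefixes of one suffix of `T`. -/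
theorem edge_comparable (hf : f ∈ edges T) (hx : f.hi = endClass T x)
    (hy : (x ++ y) <:+: T) (h : y.head? = f.lab.head?) : y <+: f.lab ∨ f.lab <+: y := by
  obtain ⟨-, hne, -, -, hb⟩ := edge_spec hf hx
  obtain ⟨i, hi⟩ := begPos_nonempty.2 hy
  have h1 : i ∈ begPos T (x ++ f.lab.take 1) := by
    refine begPos_subset_of_prefix ((List.prefix_append_right_inj _).2 ?_) hi
    obtain ⟨b, s, hs⟩ := List.exists_cons_of_ne_nil hne
    rw [hs] at h ⊢
    cases y <;> simp_all
  rw [hb 1 one_pos (List.length_pos_of_ne_nil hne)] at h1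
  have := List.prefix_or_prefix_of_prefix (mem_begPos.1 hi).2 (mem_begPos.1 h1).2
  simpa [List.prefix_append_right_inj] using this

/-- If the labels differed, one would be a proper prefix of the other, and a right-maximal string
would end inside an edge. -/
theorem edge_eq (hf : f ∈ edges T) {g : Edge A} (hg : g ∈ edges T) (h : f.hi = g.hi)
    (hl : f.lab.head? = g.lab.head?) : f = g := by
  obtain ⟨x, a, hx⟩ := id hf
  have hfx := hx.2.2.2.2.1
  have hgx := h.symm.trans hfx
  obtain ⟨-, -, h1, h2, -⟩ := edge_spec hf hfx
  obtain ⟨-, -, h3, h4, -⟩ := edge_spec hg hgx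
  have hlab : f.lab = g.lab := by
    by_contra hne
    have hpos : ∀ {f : Edge A}, f ∈ edges T → f.hi = endClass T x → 0 < f.lab.length :=
      fun hf h => List.length_pos_of_ne_nil (edge_spec hf h).2.1
    have aux : ∀ {f g : Edge A}, f ∈ edges T → g ∈ edges T → f.hi = endClass T x →
        g.hi = endClass T x → f.lab <+: g.lab → f.lab = g.lab := by
      intro f g hf hg hfx hgx hp
      by_contra hne
      have hlt : f.lab.length < g.lab.length :=
        lt_of_le_of_ne hp.length_le fun h => hne (hp.eq_of_length h)
      apply edge_not_rightMaximal hg hgx (hpos hf hfx) hlt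
      rw [← List.prefix_iff_eq_take.1 hp]
      exact (edge_spec hf hfx).2.2.1
    rcases edge_comparable hg hgx h1.1 hl with hp | hp
    · exact hne (aux hf hg hfx hgx hp)
    · exact hne (aux hg hf hgx hfx hp).symm
  ext1
  · exact h
  · exact hlab
  · rw [h2, h4, hlab]

theorem pathSpells_endClass (h : PathSpells T (source T) w v) : v = endClass T w := by
  induction h with
  | nil => rfl
  | snoc _ hf ih => exact (edge_spec hf ih).2.2.2.1

theorem pathSpells_of_rightMaximal (hx : RightMaximal T x) :
    PathSpells T (source T) x (endClass T x) := by
  -- Induction on the unread part `z`: the matching edge cannot be longer than `z`, for then `x`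
  -- would end inside it.
  suffices H : ∀ n (y z : List A), z.length = n → x = y ++ z → RightMaximal T y →
      PathSpells T (source T) y (endClass T y) → PathSpells T (source T) x (endClass T x) from
    H _ [] x rfl rfl rightMaximal_nil (.nil _)
  intro n
  induction n using Nat.strong_induction_on with
  | _ n ih =>
    rintro y z hz rfl hy hp
    obtain _ | ⟨a, z⟩ := z
    · simpa using hp
    · obtain ⟨f, hf, hfy, hfa⟩ := exists_edge (a := a) hy
        (List.IsInfix.trans ⟨[], z, by simp⟩ hx.1)
      obtain ⟨-, hne, hm, hlo, -⟩ := edge_spec hf hfy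
      have hpre : f.lab <+: a :: z := by
        rcases edge_comparable hf hfy hx.1 (by simp [hfa]) with h | h
        · rcases h.length_le.lt_or_eq with hlt | heq
          · refine absurd hx ?_
            rw [List.prefix_iff_eq_take.1 h]
            exact edge_not_rightMaximal hf hfy (by simp) hlt
          · rw [h.eq_of_length heq]
        · exact h
      obtain ⟨s, hs⟩ := hpre
      have hpos := List.length_pos_of_ne_nil hne
      have hlen := congrArg List.length hs
      rw [List.length_append, hz] at hlen
      refine ih s.length (by omega) (y ++ f.lab) s rfl (by simp [hs]) hm ?_
      rw [← hlo]
      exact .snoc (hfy ▸ hp) hf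

theorem exists_isValue (hv : v ∈ nodes T) : ∃ w, IsValue v w := by
  obtain ⟨y, hy, rfl⟩ := mem_nodes.1 hv
  obtain ⟨i, hi⟩ := endPos_nonempty.2 hy.1
  have hfin : (endClass T y).Finite := by
    refine (List.finite_toSet (T.take i).tails).subset fun z hz => ?_
    exact List.mem_tails _ _ |>.2 (mem_endPos.1 (hz.symm ▸ hi : i ∈ endPos T z)).2
  obtain ⟨y, hy, hm⟩ := Set.exists_max_image _ List.length hfin ⟨y, rfl⟩
  exact ⟨y, hy, hm⟩

/-- A longer member of `v` ends with some `a :: w`, which then lies in `v` because classes are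
intervals. -/
theorem isValue_iff (hv : v ∈ nodes T) (hw : w ∈ v) :
    IsValue v w ↔ ∀ a, endPos T (a :: w) ≠ endPos T w := by
  obtain rfl := endClass_eq_of_mem hv hw
  have hwT := (RightMaximal.of_endClass_mem_nodes hv).1
  constructor
  · intro h a ha
    have := h.2 (a :: w) ha
    simp at this
  · refine fun h => ⟨hw, fun z hz => ?_⟩
    by_contra! hlt
    obtain ⟨s, hs⟩ := suffix_of_endPos_eq hwT hz.symm hlt.le
    rcases List.eq_nil_or_concat s with rfl | ⟨s, a, rfl⟩
    · simp at hs; simp [hs] at hlt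
    · exact h a (endPos_eq_of_suffix_suffix hz.symm (List.suffix_cons _ _)
        ⟨s, by rw [← hs]; simp⟩)

theorem isMaximalRepeat_of_isValue (hv : v ∈ nodes T) (hw : IsValue v w) (ho : 1 < occ T w) :
    IsMaximalRepeat T w := by
  have hm : RightMaximal T w := .of_endClass_mem_nodes (endClass_eq_of_mem hv hw.1 ▸ hv)
  refine ⟨ho, fun a => ?_, fun a => ?_⟩
  · rw [occ_eq_ncard_endPos, occ_eq_ncard_endPos]
    exact Set.ncard_lt_ncard ((endPos_subset_of_suffix (List.suffix_cons _ _)).ssubset_of_ne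
      ((isValue_iff hv hw.1).1 hw a)) endPos_finite
  · exact Set.ncard_lt_ncard ((begPos_subset_of_prefix (List.prefix_append _ _)).ssubset_of_ne
      fun h => hm.2 a (begPos_snoc_eq_iff.1 h)) begPos_finite

theorem occ_pos (h : x <:+: T) : 0 < occ T x :=
  (Set.ncard_pos begPos_finite).2 (begPos_nonempty.2 h)

end Classes

/-! ### Type-2 nodes as the stops of a walk along the label of an edge. -/

section Walk

variable {A : Type u} {T x y z w : List A} {a : A} {v u u' : Set (List A)} {f g : Edge A} {k i : ℕ}

/-- `x` is the shortest string of `v`. -/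
def IsShortest (v : Set (List A)) (x : List A) : Prop := x ∈ v ∧ ∀ z ∈ v, x.length ≤ z.length

theorem IsShortest.unique (hv : v ∈ nodes T) (hx : IsShortest v x) (hy : IsShortest v y) :
    x = y := by
  obtain rfl := endClass_eq_of_mem hv hx.1
  exact (suffix_of_endPos_eq (RightMaximal.of_endClass_mem_nodes hv).1 (Eq.symm hy.1)
    (hx.2 _ hy.1)).eq_of_length ((hx.2 _ hy.1).antisymm (hy.2 _ hx.1))

theorem hi_mem_nodes (hf : f ∈ edges T) : f.hi ∈ nodes T := by
  obtain ⟨x, -, -, -, -, -, hx, -⟩ := id hf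
  exact mem_nodes.2 ⟨x, (edge_spec hf hx).1, hx⟩

/-- For the shortest string `x` of the source of the edge `f`, the path that spells `x` and the
first `k` characters of the label of `f`, without its first character, ends at the node `u`. -/
def WalksTo (T : List A) (f : Edge A) (k : ℕ) (u : Set (List A)) : Prop :=
  ∃ x b z, IsShortest f.hi x ∧ x ++ f.lab.take k = b :: z ∧ RightMaximal T z ∧ u = endClass T z

theorem WalksTo.unique (hf : f ∈ edges T) (h : WalksTo T f k u) (h' : WalksTo T f k u') :
    u = u' := by
  obtain ⟨x, b, z, hx, hz, -, rfl⟩ := h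
  obtain ⟨x', b', z', hx', hz', -, rfl⟩ := h'
  obtain rfl := hx.unique (hi_mem_nodes hf) hx'
  rw [hz] at hz'
  rw [(List.cons.inj hz').2]

/-- The point is that `x` is shortest. A shorter member of the node would be a suffix of `x` without
its first letter, and then `a :: w` and `w` would have the same ending positions. -/
theorem IsType2Node.spec (hf : f ∈ edges T) (h : IsType2Node T f k u) :
    0 < k ∧ k < f.lab.length ∧ ∃ w a x, IsValue u w ∧ (a :: w) <:+: T ∧ IsShortest f.hi x ∧
      x ++ f.lab.take k = a :: w := by
  obtain ⟨hu, w, a, hw, haw, -, hk, hk', x, hx, hxw⟩ := h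
  have hhi := pathSpells_endClass hx
  have hxm : x ∈ f.hi := by rw [hhi]; rfl
  refine ⟨hk, hk', w, a, x, hw, haw, ⟨hxm, fun z hz => ?_⟩, hxw.symm⟩
  by_contra! hlt
  obtain _ | ⟨b, x⟩ := x
  · simp at hlt
  obtain ⟨rfl, rfl⟩ := List.cons.inj hxw
  have hzx : endPos T z = endPos T (a :: x) := by rwa [hhi] at hz
  have h1 := suffix_of_endPos_eq (infix_congr hzx.symm (edge_spec hf hhi).1.1) hzx hlt.le
  have h2 : z <:+ x := by
    refine List.suffix_of_suffix_length_le h1 (List.suffix_cons _ _) ?_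
    simp at hlt; omega
  have h3 := endPos_eq_of_suffix_suffix hzx h2 (List.suffix_cons _ _)
  exact (isValue_iff hu hw.1).1 hw a (endPos_append_congr (hzx.symm.trans h3.symm) _)

theorem isType2Node_iff (hf : f ∈ edges T) :
    IsType2Node T f k u ↔ 0 < k ∧ k < f.lab.length ∧ WalksTo T f k u := by
  have hn := hi_mem_nodes hf
  constructor
  · intro h
    obtain ⟨hk, hk', w, a, x, hw, -, hx, hxw⟩ := h.spec hf
    have huw := endClass_eq_of_mem h.1 hw.1
    exact ⟨hk, hk', x, a, w, hx, hxw, .of_endClass_mem_nodes (T := T) (huw ▸ h.1), huw⟩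
  · rintro ⟨hk, hk', x, b, z, hx, hz, hm, rfl⟩
    have hhi := endClass_eq_of_mem hn hx.1
    obtain ⟨hxm, -, hxf, -, -⟩ := edge_spec hf hhi
    have hb : (b :: z) <:+: T := by
      rw [← hz]
      refine List.IsInfix.trans (List.IsPrefix.isInfix ?_) hxf.1
      exact (List.prefix_append_right_inj _).2 (List.take_prefix _ _)
    refine ⟨hm.endClass_mem_nodes, z, b, ?_, hb, hf, hk, hk', x, ?_, hz.symm⟩
    -- A letter `a` that precedes all occurrences of `z` must be `b`, as `b :: z` occurs. But then
    -- `b :: z` would be right-maximal like `z`, although it ends inside the edge `f`.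
    · refine (isValue_iff hm.endClass_mem_nodes rfl).2 fun a ha => ?_
      have hab : a = b := by
        obtain ⟨j, hj⟩ := endPos_nonempty.2 hb
        have h1 := endPos_subset_of_suffix (List.suffix_cons _ _) hj
        rw [← ha] at h1
        have := List.suffix_of_suffix_length_le (mem_endPos.1 h1).2 (mem_endPos.1 hj).2
          (by simp)
        simpa using this.eq_of_length (by simp)
      subst hab
      refine edge_not_rightMaximal hf hhi hk hk' ?_
      rw [hz]
      exact hm.congr ha.symm
    · rw [hhi]
      exact pathSpells_of_rightMaximal hxm

theorem WalksTo.infix (hf : f ∈ edges T) {b : A} (hx : IsShortest f.hi x)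
    (hz : x ++ f.lab.take k = b :: z) : (z ++ f.lab.drop k) <:+: T := by
  obtain ⟨-, -, hm, -⟩ := edge_spec hf (endClass_eq_of_mem (hi_mem_nodes hf) hx.1)
  refine List.IsInfix.trans ⟨[b], [], ?_⟩ hm.1
  conv_rhs => rw [← List.take_append_drop k f.lab, ← List.append_assoc, hz]
  simp

theorem WalksTo.exists_edge (hf : f ∈ edges T) (h : WalksTo T f k u) (hk : k < f.lab.length) :
    ∃ g ∈ edges T, g.hi = u ∧ g.lab.head? = f.lab[k]? := by
  obtain ⟨x, b, z, hx, hz, hm, rfl⟩ := h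
  obtain ⟨g, hg, h1, h2⟩ := LCDAWG.exists_edge (a := f.lab[k]) hm
    (List.IsInfix.trans ⟨[], f.lab.drop (k + 1), by simp⟩ (WalksTo.infix hf hx hz))
  exact ⟨g, hg, h1, by simp [h2, hk]⟩

/-- The label of `g` and the unread part of the label of `f` are comparable. If the former is the
shorter, the walk reaches the end of `g`; in both cases it is inside `g` in between. -/
theorem WalksTo.step (hf : f ∈ edges T) (h : WalksTo T f k u) (hg : g ∈ edges T) (hgu : g.hi = u)
    (hh : g.lab.head? = f.lab[k]?) :
    (k + g.lab.length < f.lab.length → WalksTo T f (k + g.lab.length) g.lo) ∧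
    ∀ i u', k < i → i < k + g.lab.length → i < f.lab.length → ¬ WalksTo T f i u' := by
  obtain ⟨x, b, z, hx, hz, hm, rfl⟩ := h
  have hc := edge_comparable hg hgu (WalksTo.infix hf hx hz) (by rw [hh]; simp)
  have htake : ∀ j, x ++ f.lab.take (k + j) = b :: (z ++ (f.lab.drop k).take j) := by
    intro j
    rw [List.take_add, ← List.append_assoc, hz]
    rfl
  constructor
  · intro hl
    have hp : g.lab <+: f.lab.drop k := by
      refine hc.resolve_left fun h => ?_
      have := h.length_le
      simp at this
      omega
    refine ⟨x, b, z ++ g.lab, hx, ?_, (edge_spec hg hgu).2.2.1, (edge_spec hg hgu).2.2.2.1⟩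
    rw [htake, ← List.prefix_iff_eq_take.1 hp]
  · rintro i u' hi hi' hi'' ⟨x', b', z', hx', hz', hm', -⟩
    obtain rfl := hx.unique (hi_mem_nodes hf) hx'
    obtain ⟨j, rfl⟩ := Nat.exists_eq_add_of_le hi.le
    rw [htake] at hz'
    obtain ⟨-, rfl⟩ := List.cons.inj hz'
    have : (f.lab.drop k).take j = g.lab.take j := by
      rcases hc with h | h
      · rw [List.prefix_iff_eq_take.1 h, List.take_take]
        congr 1
        simp
        omega
      · rw [List.prefix_iff_eq_take.1 h, List.take_take]
        congr 1
        omega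
    rw [this] at hm'
    exact edge_not_rightMaximal hg hgu (by omega) (by omega) hm'

theorem walksTo_source (hf : f ∈ edges T) (h : f.hi = source T) : WalksTo T f 1 (source T) := by
  obtain ⟨b, s, hs⟩ := List.exists_cons_of_ne_nil (edge_spec hf h).2.1
  exact ⟨[], b, [], ⟨by rw [h]; rfl, by simp⟩, by simp [hs], rightMaximal_nil, rfl⟩

/-- With `y` the longest suffix of the value outside the node, the suffix `b :: y` is the shortest
member: any shorter member would be a suffix of `y` and would force `y` into the node. -/
theorem walksTo_suffixLink (hu : u ∈ nodes T) (h : IsSuffixLink T f.hi u) :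
    WalksTo T f 0 u := by
  obtain ⟨hv, w, y, hw, hy, hyv, hmax, rfl⟩ := h
  have hvw := endClass_eq_of_mem hv hw.1
  have hwT : w <:+: T := by rw [hvw] at hv; exact (RightMaximal.of_endClass_mem_nodes hv).1
  obtain ⟨s, hs⟩ := hy
  rcases List.eq_nil_or_concat s with rfl | ⟨s, b, rfl⟩
  · exact absurd hw.1 (by rw [← hs]; exact hyv)
  have hb : (b :: y) <:+ w := ⟨s, by rw [← hs]; simp⟩
  refine ⟨b :: y, b, y, ⟨?_, fun z hz => ?_⟩, by simp, .of_endClass_mem_nodes hu, rfl⟩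
  · by_contra hn
    simpa using hmax _ hb hn
  · by_contra! hlt
    have hzw : endPos T z = endPos T w := by rwa [hvw] at hz
    have h1 := suffix_of_endPos_eq (infix_congr hzw.symm hwT) hzw (hw.2 z hz)
    have h2 : z <:+ y := List.suffix_of_suffix_length_le h1 ⟨_, hs⟩ (by simp at hlt; omega)
    apply hyv
    rw [hvw]
    exact (endPos_eq_of_suffix_suffix hzw h2 ⟨_, hs⟩).trans hzw

end Walk

/-! ### Edges and type-2 nodes are bounded by extensions of maximal repeats. -/

section Counting

variable {A : Type u} {T : List A}

theorem infix_finite (T : List A) : {y | y <:+: T}.Finite :=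
  (List.finite_toSet T.sublists).subset fun _ h => List.mem_sublists.2 h.sublist

theorem leftExtensions_finite : (leftExtensions T).Finite :=
  (infix_finite T).subset fun _ ⟨_, _, _, _, h⟩ => h

theorem rightExtensions_finite : (rightExtensions T).Finite :=
  (infix_finite T).subset fun _ ⟨_, _, _, _, h⟩ => h

theorem one_lt_occ_of_rightMaximal {w : List A} {a : A} (hw : RightMaximal T w)
    (ha : (w ++ [a]) <:+: T) : 1 < occ T w :=
  (Nat.succ_le_of_lt (occ_pos ha)).trans_lt <|
    Set.ncard_lt_ncard ((begPos_subset_of_prefix (List.prefix_append _ _)).ssubset_of_ne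
      fun h => hw.2 a (begPos_snoc_eq_iff.1 h)) begPos_finite

theorem one_lt_occ_of_isValue {v : Set (List A)} {w : List A} {a : A} (hv : v ∈ nodes T)
    (hw : IsValue v w) (ha : (a :: w) <:+: T) : 1 < occ T w := by
  refine (Nat.succ_le_of_lt (occ_pos ha)).trans_lt ?_
  rw [occ_eq_ncard_endPos, occ_eq_ncard_endPos]
  exact Set.ncard_lt_ncard ((endPos_subset_of_suffix (List.suffix_cons _ _)).ssubset_of_ne
      ((isValue_iff hv hw.1).1 hw a)) endPos_finite

/-- An edge is sent to the value of its upper node followed by the first letter of its label;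
`edge_eq` makes this injective. -/
theorem edges_ncard_le {s : Finset (Edge A)} (hs : ∀ f ∈ s, f ∈ edges T) :
    s.card ≤ (rightExtensions T).ncard := by
  classical
  rw [Set.ncard_eq_toFinset_card _ rightExtensions_finite]
  refine Finset.card_le_card_of_forall_subsingleton
    (fun f y => ∃ w, IsValue f.hi w ∧ ∃ a, f.lab.head? = some a ∧ y = w ++ [a]) ?_ ?_
  · intro f hf
    have hfe := hs f hf
    have hn := hi_mem_nodes hfe
    obtain ⟨w, hw⟩ := exists_isValue hn
    obtain ⟨h1, h2, h3, -⟩ := edge_spec hfe (endClass_eq_of_mem hn hw.1)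
    obtain ⟨a, l, hl⟩ := List.exists_cons_of_ne_nil h2
    have ha : (w ++ [a]) <:+: T := List.IsInfix.trans ⟨[], l, by simp [hl]⟩ h3.1
    refine ⟨w ++ [a], ?_, w, hw, a, by simp [hl], rfl⟩
    rw [Set.Finite.mem_toFinset]
    exact ⟨w, a, isMaximalRepeat_of_isValue hn hw (one_lt_occ_of_rightMaximal h1 ha), rfl, ha⟩
  · rintro y - f ⟨hf, w, hw, a, ha, rfl⟩ g ⟨hg, w', hw', a', ha', h⟩
    obtain ⟨rfl, h⟩ := List.append_inj' h rfl
    obtain rfl : a = a' := by simpa using h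
    have hf := hs f hf
    have hg := hs g hg
    exact edge_eq hf hg ((endClass_eq_of_mem (hi_mem_nodes hf) hw.1).trans
      (endClass_eq_of_mem (hi_mem_nodes hg) hw'.1).symm) (ha.trans ha'.symm)

theorem isShortest_append_take_inj {f g : Edge A} {x y : List A} {k l : ℕ} (hf : f ∈ edges T)
    (hg : g ∈ edges T) (hx : IsShortest f.hi x) (hy : IsShortest g.hi y) (hk : 0 < k)
    (hk' : k < f.lab.length) (hl : 0 < l) (hl' : l < g.lab.length)
    (h : x ++ f.lab.take k = y ++ g.lab.take l) : f = g ∧ k = l := by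
  have hfx := endClass_eq_of_mem (hi_mem_nodes hf) hx.1
  have hgy := endClass_eq_of_mem (hi_mem_nodes hg) hy.1
  -- If `y` were longer than `x`, the right-maximal string `y` would end inside the edge `f`.
  have aux : ∀ {f g : Edge A} {x y : List A} {k l : ℕ}, f ∈ edges T → g ∈ edges T →
      f.hi = endClass T x → g.hi = endClass T y → 0 < k → k < f.lab.length →
      x ++ f.lab.take k = y ++ g.lab.take l → y.length ≤ x.length := by
    clear * -
    intro f g x y k l hf hg hfx hgy hk hk' h
    by_contra! hlt
    have hp : y <+: x ++ f.lab.take k := ⟨_, h.symm⟩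
    have hlen := hp.length_le
    simp only [List.length_append, List.length_take] at hlen
    have hy : y = x ++ f.lab.take (y.length - x.length) := by
      have := List.prefix_iff_eq_take.1 hp
      rw [List.take_append, List.take_of_length_le hlt.le, List.take_take,
        min_eq_left (by omega)] at this
      exact this
    have := (edge_spec hg hgy).1
    rw [hy] at this
    exact edge_not_rightMaximal hf hfx (by omega) (by omega) this
  have hlen := (aux hg hf hgy hfx hl hl' h.symm).antisymm (aux hf hg hfx hgy hk hk' h)
  obtain ⟨rfl, h'⟩ := List.append_inj h hlen
  clear h
  refine ⟨edge_eq hf hg (hfx.trans hgy.symm) ?_, ?_⟩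
  · have := congrArg List.head? h'
    rwa [List.head?_take, List.head?_take, if_neg hk.ne', if_neg hl.ne'] at this
  · have := congrArg List.length h'
    simp at this
    omega

variable [LinearOrder A] (R : CdawgRep T)

theorem CdawgRep.edge_mem (e : Fin R.numEdges) : R.edge e ∈ edges T :=
  R.range_edge ▸ Set.mem_range_self e

theorem CdawgRep.node_mem (v : Fin R.numNodes) : R.node v ∈ nodes T :=
  R.range_node ▸ Set.mem_range_self v

theorem CdawgRep.numEdges_le : R.numEdges ≤ (rightExtensions T).ncard := by
  classical
  have := edges_ncard_le (T := T) (s := Finset.univ.map ⟨R.edge, R.edge_injective⟩) (by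
    intro f hf
    obtain ⟨e, -, rfl⟩ := Finset.mem_map.1 hf
    exact R.edge_mem e)
  simpa using this

theorem CdawgRep.lab_prefix (e : Fin R.numEdges) : (R.edge e).lab <+: T.drop (R.labBeg e) :=
  (mem_begPos.1 (R.labBeg_mem e)).2

theorem CdawgRep.lab_pos (e : Fin R.numEdges) : 0 < (R.edge e).lab.length := by
  obtain ⟨x, -, -, -, -, -, h, -⟩ := R.edge_mem e
  exact List.length_pos_of_ne_nil (edge_spec (R.edge_mem e) h).2.1

theorem CdawgRep.labBeg_add_le (e : Fin R.numEdges) :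
    R.labBeg e + (R.edge e).lab.length ≤ T.length := by
  have := (R.lab_prefix e).length_le
  have := (mem_begPos.1 (R.labBeg_mem e)).1
  simp at *
  omega

theorem CdawgRep.getElem?_labBeg_add (e : Fin R.numEdges) {k : ℕ}
    (hk : k < (R.edge e).lab.length) : T[R.labBeg e + k]? = some (R.edge e).lab[k] := by
  obtain ⟨s, hs⟩ := R.lab_prefix e
  rw [← List.getElem?_drop, ← hs, List.getElem?_append_left hk, List.getElem?_eq_getElem hk]

/-- The first character of the label of an edge. -/
def CdawgRep.first (e : Fin R.numEdges) : A := (R.edge e).lab[0]'(R.lab_pos e)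

theorem CdawgRep.head?_lab (e : Fin R.numEdges) : (R.edge e).lab.head? = some (R.first e) := by
  rw [List.head?_eq_getElem?, List.getElem?_eq_getElem (R.lab_pos e), first]

theorem CdawgRep.first_lt (e e' : Fin R.numEdges) (h : R.hi e = R.hi e') (hlt : e < e') :
    R.first e < R.first e' :=
  R.sorted e e' h hlt _ (by simp [R.head?_lab]) _ (by simp [R.head?_lab])

theorem CdawgRep.first_lt_iff (e e' : Fin R.numEdges) (h : R.hi e = R.hi e') :
    R.first e < R.first e' ↔ e < e' := by
  refine ⟨fun hlt => ?_, R.first_lt e e' h⟩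
  by_contra! hle
  rcases hle.lt_or_eq with hl | rfl
  · exact absurd (R.first_lt _ _ h.symm hl) hlt.asymm
  · exact hlt.ne rfl

theorem CdawgRep.outDegree_le [Fintype A] (v : Fin R.numNodes) :
    R.outEnd v - R.outBeg v ≤ Fintype.card A := by
  have hE := (R.out_le v).2
  let F : Fin (R.outEnd v - R.outBeg v) → A :=
    fun i => R.first ⟨R.outBeg v + i, by omega⟩
  have hF : StrictMono F := by
    intro i j hij
    refine R.first_lt _ _ ?_ (by simpa using hij)
    rw [(R.mem_out v _).2 ⟨by simp, by simp; omega⟩, (R.mem_out v _).2 ⟨by simp, by simp; omega⟩]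
  simpa using Fintype.card_le_of_injective F hF.injective

/-- A type-2 node is sent to the string that leads to it from the shortest member of the upper node.
The first bound serves the running time; the second, cruder one keeps the output addresses
polynomial in the input size. -/
theorem CdawgRep.pairwise_length_le {L : List (Fin R.numEdges × ℕ × Fin R.numNodes)}
    (hp : L.Pairwise (fun x y => x.1 < y.1 ∨ (x.1 = y.1 ∧ x.2.1 < y.2.1)))
    (hL : ∀ x ∈ L, IsType2Node T (R.edge x.1) x.2.1 (R.node x.2.2)) :
    L.length ≤ (leftExtensions T).ncard ∧ L.length ≤ R.numEdges * T.length := by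
  classical
  have hnd : (L.map fun x => (x.1, x.2.1)).Nodup := by
    refine List.pairwise_map.2 (hp.imp fun {x y} h => ?_)
    simp only [ne_eq, Prod.mk.injEq, not_and]
    rcases h with h | ⟨_, h⟩
    · exact fun h' => absurd h' h.ne
    · exact fun _ => h.ne
  have hcard := List.toFinset_card_of_nodup hnd
  rw [List.length_map] at hcard
  have hmem : ∀ e k, (e, k) ∈ (L.map fun x => (x.1, x.2.1)).toFinset →
      ∃ u, IsType2Node T (R.edge e) k (R.node u) := by
    intro e k h
    simp only [List.mem_toFinset, List.mem_map] at h
    obtain ⟨⟨e', k', u⟩, h, h'⟩ := h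
    obtain ⟨rfl, rfl⟩ := Prod.mk.inj h'
    exact ⟨u, hL _ h⟩
  rw [← hcard]
  constructor
  · rw [Set.ncard_eq_toFinset_card _ leftExtensions_finite]
    refine Finset.card_le_card_of_forall_subsingleton
      (fun p y => ∃ x, IsShortest (R.edge p.1).hi x ∧ y = x ++ (R.edge p.1).lab.take p.2) ?_ ?_
    · rintro ⟨e, k⟩ h
      obtain ⟨u, hu⟩ := hmem e k h
      obtain ⟨-, -, w, a, x, hw, haw, hx, hxw⟩ := hu.spec (R.edge_mem e)
      refine ⟨a :: w, ?_, x, hx, hxw.symm⟩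
      rw [Set.Finite.mem_toFinset]
      exact ⟨w, a, isMaximalRepeat_of_isValue hu.1 hw (one_lt_occ_of_isValue hu.1 hw haw), rfl, haw⟩
    · rintro y - ⟨e, k⟩ ⟨h, x, hx, hy⟩ ⟨e', k'⟩ ⟨h', x', hx', hy'⟩
      obtain ⟨u, hu⟩ := hmem e k h
      obtain ⟨u', hu'⟩ := hmem e' k' h'
      obtain ⟨h1, h2, -⟩ := (isType2Node_iff (R.edge_mem e)).1 hu
      obtain ⟨h1', h2', -⟩ := (isType2Node_iff (R.edge_mem e')).1 hu'
      obtain ⟨h3, h4⟩ := isShortest_append_take_inj (R.edge_mem e) (R.edge_mem e') hx hx' h1 h2 h1'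
        h2' (hy.symm.trans hy')
      rw [R.edge_injective h3, h4]
  · have : (L.map fun x => (x.1, x.2.1)).toFinset ⊆ Finset.univ ×ˢ Finset.range T.length := by
      rintro ⟨e, k⟩ h
      obtain ⟨u, hu⟩ := hmem e k h
      obtain ⟨h1, h2, -⟩ := (isType2Node_iff (R.edge_mem e)).1 hu
      have := R.labBeg_add_le e
      simp
      omega
    simpa using Finset.card_le_card this

end Counting

/-! ### Evaluation rules and a calculus for terminating runs. -/

section Evaluation

variable {A : Type u} [LinearOrder A] {W : ℕ} {T : List A} {s : Config} {l r e : RExpr} {x y k i : ℕ}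

theorem value_const (h : k < W) : (RExpr.const k).value W T s = some k := if_pos h

theorem value_reg (h : s.reg i = x) : (RExpr.reg i).value W T s = some x := congrArg some h

theorem value_op {o : Op} (hl : l.value W T s = some x) (hr : r.value W T s = some y)
    (h : o.apply x y < W) : (RExpr.op o l r).value W T s = some (o.apply x y) := by
  simp only [RExpr.value, hl, hr, if_pos h]

theorem value_add (hl : l.value W T s = some x) (hr : r.value W T s = some y) (h : x + y < W) :
    (RExpr.op .add l r).value W T s = some (x + y) := value_op hl hr h

theorem value_sub (hl : l.value W T s = some x) (hr : r.value W T s = some y) (h : x - y < W) :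
    (RExpr.op .sub l r).value W T s = some (x - y) := value_op hl hr h

theorem value_mul (hl : l.value W T s = some x) (hr : r.value W T s = some y) (h : x * y < W) :
    (RExpr.op .mul l r).value W T s = some (x * y) := value_op hl hr h

theorem value_div (hl : l.value W T s = some x) (hr : r.value W T s = some y) (h : x / y < W) :
    (RExpr.op .div l r).value W T s = some (x / y) := value_op hl hr h

theorem value_lt (hl : l.value W T s = some x) (hr : r.value W T s = some y) (h : 1 < W) :
    (RExpr.op .lt l r).value W T s = some (if x < y then 1 else 0) :=
  value_op hl hr (by simp only [Op.apply]; split <;> omega)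

theorem value_mem (he : e.value W T s = some x) : (RExpr.mem e).value W T s = some (s.mem x) := by
  simp only [RExpr.value, he, Option.map_some]

theorem value_charLt {c d : A} (hl : l.value W T s = some x) (hr : r.value W T s = some y)
    (hc : T[x]? = some c) (hd : T[y]? = some d) :
    (RExpr.charLt l r).value W T s = some (if c < d then 1 else 0) := by
  simp only [RExpr.value, hl, hr, hc, hd]

end Evaluation

section Runs

variable {A : Type u} [LinearOrder A] {W : ℕ} {T : List A} {s : Config} {p q : Prog} {d e : RExpr}
  {x a i : ℕ} {Q Q' : ℕ → Config → Prop}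

/-- The program `p` started in `s` halts, and its running time and final configuration
satisfy `Q`. -/
def Runs (W : ℕ) (T : List A) (p : Prog) (s : Config) (Q : ℕ → Config → Prop) : Prop :=
  ∃ t s', Exec W T p s t s' ∧ Q t s'

theorem Runs.mono (h : Runs W T p s Q) (hQ : ∀ t s', Q t s' → Q' t s') : Runs W T p s Q' := by
  obtain ⟨t, s', h, h'⟩ := h
  exact ⟨t, s', h, hQ _ _ h'⟩

theorem Runs.skip (h : Q 1 s) : Runs W T .skip s Q := ⟨_, _, .skip s, h⟩

theorem Runs.assign (he : e.value W T s = some x)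
    (h : Q (e.cost + 1) ⟨Function.update s.reg i x, s.mem⟩) : Runs W T (.assign i e) s Q :=
  ⟨_, _, .assign he, h⟩

theorem Runs.store (hd : d.value W T s = some a) (he : e.value W T s = some x)
    (h : Q (d.cost + e.cost + 1) ⟨s.reg, Function.update s.mem a x⟩) :
    Runs W T (.store d e) s Q :=
  ⟨_, _, .store hd he, h⟩

theorem Runs.seq (h : Runs W T p s fun t s' => Runs W T q s' fun t' s'' => Q (t + t') s'') :
    Runs W T (.seq p q) s Q := by
  obtain ⟨t, s', h, t', s'', h', hQ⟩ := h
  exact ⟨_, _, .seq h h', hQ⟩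

theorem Runs.ite_true (he : e.value W T s = some x) (hx : x ≠ 0)
    (h : Runs W T p s fun t s' => Q (e.cost + 1 + t) s') : Runs W T (.ite e p q) s Q := by
  obtain ⟨t, s', h, hQ⟩ := h
  exact ⟨_, _, .ite_true he hx h, hQ⟩

theorem Runs.ite_false (he : e.value W T s = some 0)
    (h : Runs W T q s fun t s' => Q (e.cost + 1 + t) s') : Runs W T (.ite e p q) s Q := by
  obtain ⟨t, s', h, hQ⟩ := h
  exact ⟨_, _, .ite_false he h, hQ⟩

theorem Runs.loop_true (he : e.value W T s = some x) (hx : x ≠ 0)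
    (h : Runs W T p s fun t s' =>
      Runs W T (.loop e p) s' fun t' s'' => Q (e.cost + 1 + t + t') s'') :
    Runs W T (.loop e p) s Q := by
  obtain ⟨t, s', h, t', s'', h', hQ⟩ := h
  exact ⟨_, _, .loop_true he hx h h', hQ⟩

theorem Runs.loop_false (he : e.value W T s = some 0) (h : Q (e.cost + 1) s) :
    Runs W T (.loop e p) s Q :=
  ⟨_, _, .loop_false he, h⟩

end Runs

/-! ### The program. -/

section Program

/-- The cell `i` of the node whose number is the value of `v`. -/
def nodeCell (i : ℕ) (v : RExpr) : RExpr :=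
  .mem (.op .add (.op .add (.const 4) (.op .mul (.const 3) v)) (.const i))

/-- The cell `i` of the edge whose number is the value of `e`; register `3` contains the address of
the array of the edges. -/
def edgeCell (i : ℕ) (e : RExpr) : RExpr :=
  .mem (.op .add (.op .add (.reg 3) (.op .mul (.const 4) e)) (.const i))

/-- Between the edges with numbers in registers `8` and `9`, find the edge whose label begins with
the character of the text at the position in register `11`. -/
def bisect : Prog :=
  .loop (.op .lt (.op .add (.reg 8) (.const 1)) (.reg 9))
    (.seq (.assign 10 (.op .div (.op .add (.reg 8) (.reg 9)) (.const 2)))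
      (.ite (.charLt (.reg 11) (edgeCell 1 (.reg 10)))
        (.assign 9 (.reg 10))
        (.assign 8 (.reg 10))))

/-- Append the triple in registers `2`, `5` and `4` to the output. -/
def emit : Prog :=
  .seq (.store (.op .add (.reg 0) (.op .mul (.const 3) (.reg 1))) (.reg 2))
  (.seq (.store (.op .add (.op .add (.reg 0) (.op .mul (.const 3) (.reg 1))) (.const 1)) (.reg 5))
  (.seq (.store (.op .add (.op .add (.reg 0) (.op .mul (.const 3) (.reg 1))) (.const 2)) (.reg 4))
  (.assign 1 (.op .add (.reg 1) (.const 1)))))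

/-- From the node in register `4`, follow the edge whose label begins with the character after the
first `k` characters of the label of the edge in register `2`, where `k` is in register `5`. -/
def follow : Prog :=
  .seq (.assign 11 (.op .add (edgeCell 1 (.reg 2)) (.reg 5)))
  (.seq (.assign 8 (nodeCell 1 (.reg 4)))
  (.seq (.assign 9 (nodeCell 2 (.reg 4)))
  (.seq bisect
  (.seq (.assign 5 (.op .add (.reg 5)
    (.op .sub (edgeCell 2 (.reg 8)) (edgeCell 1 (.reg 8)))))
  (.assign 4 (edgeCell 3 (.reg 8)))))))

/-- Walk along the label of the edge in register `2`, whose length is in register `6`, and output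
the nodes on the way. -/
def walk : Prog :=
  .loop (.op .lt (.reg 5) (.reg 6)) (.seq (.ite (.reg 5) emit .skip) follow)

/-- Set registers `4`, `5`, `6` to the start of the walk for the edge in register `2`. -/
def startWalk : Prog :=
  .seq (.assign 6 (.op .sub (edgeCell 2 (.reg 2)) (edgeCell 1 (.reg 2))))
  (.seq (.assign 4 (edgeCell 0 (.reg 2)))
  -- The sum of the two tests is nonzero exactly when the node is not the root.
  (.ite (.op .add (.op .lt (.mem (.const 3)) (.reg 4)) (.op .lt (.reg 4) (.mem (.const 3))))
    (.seq (.assign 4 (nodeCell 0 (.reg 4))) (.assign 5 (.const 0)))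
    (.assign 5 (.const 1))))

/-- The computation of the type-2 nodes for all edges. -/
def allWalks : Prog :=
  .loop (.op .lt (.reg 2) (.mem (.const 2)))
    (.seq startWalk (.seq walk (.assign 2 (.op .add (.reg 2) (.const 1)))))

/-- The program that computes all type-2 nodes. -/
def type2Program : Prog :=
  .seq (.assign 3 (.op .add (.const 4) (.op .mul (.const 3) (.mem (.const 1)))))
  -- The output starts right behind the representation, which is therefore never overwritten.
  (.seq (.assign 0 (.op .add (.reg 3) (.op .mul (.const 4) (.mem (.const 2)))))
  allWalks)

end Program

/-! ### Correctness and cost of a single jump. -/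

section Correctness

variable {A : Type u} [LinearOrder A] {T : List A} {W : ℕ} {s : Config} (R : CdawgRep T)

theorem value_nodeCell {e : RExpr} {i v : ℕ} (he : e.value W T s = some v)
    (h : 4 + 3 * v + i < W) : (nodeCell i e).value W T s = some (s.mem (4 + 3 * v + i)) :=
  value_mem (value_add (value_add (value_const (by omega))
    (value_mul (value_const (by omega)) he (by omega)) (by omega)) (value_const (by omega)) h)

theorem value_edgeCell {e : RExpr} {i v b : ℕ} (hb : s.reg 3 = b) (he : e.value W T s = some v)
    (h : b + 4 * v + i < W) (hW : 4 < W) :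
    (edgeCell i e).value W T s = some (s.mem (b + 4 * v + i)) :=
  value_mem (value_add (value_add (value_reg hb)
    (value_mul (value_const hW) he (by omega)) (by omega)) (value_const (by omega)) h)

/-- The memory holds the representation `R`, except perhaps for the length of the text. -/
structure CdawgRep.Stored (m : ℕ → ℕ) : Prop where
  numEdges : m 2 = R.numEdges
  root : m 3 = R.root
  -- The summand `0` matches the address computed by `nodeCell 0`.
  slink : ∀ v : Fin R.numNodes, m (4 + 3 * v.val + 0) = R.slink v
  outBeg : ∀ v : Fin R.numNodes, m (4 + 3 * v.val + 1) = R.outBeg v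
  outEnd : ∀ v : Fin R.numNodes, m (4 + 3 * v.val + 2) = R.outEnd v
  hi : ∀ e : Fin R.numEdges, m (4 + 3 * R.numNodes + 4 * e.val + 0) = R.hi e
  labBeg : ∀ e : Fin R.numEdges, m (4 + 3 * R.numNodes + 4 * e.val + 1) = R.labBeg e
  labEnd : ∀ e : Fin R.numEdges, m (4 + 3 * R.numNodes + 4 * e.val + 2) =
    R.labBeg e + (R.edge e).lab.length
  lo : ∀ e : Fin R.numEdges, m (4 + 3 * R.numNodes + 4 * e.val + 3) = R.lo e

variable {R}

theorem CdawgRep.Loaded.stored {m m' : ℕ → ℕ} (h : R.Loaded m)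
    (h' : ∀ a < R.cells, m' a = m a) : R.Stored m' := by
  have hc : R.cells = 4 + 3 * R.numNodes + 4 * R.numEdges := rfl
  constructor
  · rw [h' _ (by omega), h.numEdges]
  · rw [h' _ (by omega), h.root]
  · intro v; rw [h' _ (by omega)]; exact h.slink v
  · intro v; rw [h' _ (by omega)]; exact h.outBeg v
  · intro v; rw [h' _ (by omega)]; exact h.outEnd v
  · intro e; rw [h' _ (by omega)]; exact h.hi e
  · intro e; rw [h' _ (by omega)]; exact h.labBeg e
  · intro e; rw [h' _ (by omega)]; exact h.labEnd e
  · intro e; rw [h' _ (by omega)]; exact h.lo e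

/-- The invariant is that `g` lies in the half-open interval given by registers `8` and `9`, whose
length is halved in each of at most `n` rounds. -/
theorem runs_bisect {v : Fin R.numNodes} {g : Fin R.numEdges} (hg : R.hi g = v)
    (hW : 8 * R.size + 8 < W) (n : ℕ) :
    ∀ s : Config, R.Stored s.mem → s.reg 3 = 4 + 3 * R.numNodes →
    T[s.reg 11]? = some (R.first g) →
    R.outBeg v ≤ s.reg 8 → s.reg 8 ≤ g → g < s.reg 9 → s.reg 9 ≤ R.outEnd v →
    s.reg 9 - s.reg 8 ≤ 2 ^ n →
    Runs W T bisect s fun t s' => t ≤ 30 * n + 10 ∧ s'.mem = s.mem ∧ s'.reg 8 = g ∧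
      ∀ i < 8, s'.reg i = s.reg i := by
  have hsize : R.size = T.length + (4 + 3 * R.numNodes + 4 * R.numEdges) := rfl
  have hE := (R.out_le v).2
  induction n with
  | zero =>
    intro s hs h3 h11 h1 h2 h3 h4 h5
    refine Runs.loop_false (value_lt (value_add (value_reg rfl) (value_const (by omega)) (by omega))
      (value_reg rfl) (by omega) |>.trans ?_) ⟨by simp [RExpr.cost], rfl, by omega, fun i _ => rfl⟩
    rw [if_neg (by omega)]
  | succ n ih =>
    intro s hs h3 h11 h1 h2 h4 h5 h6
    rw [pow_succ] at h6
    have hguard := value_lt (T := T) (value_add (value_reg (s := s) (i := 8) rfl)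
      (value_const (k := 1) (W := W) (by omega)) (by omega)) (value_reg (i := 9) rfl) (by omega)
    by_cases hlt : s.reg 8 + 1 < s.reg 9
    · refine Runs.loop_true hguard (by simp [hlt]) (Runs.seq (Runs.assign
        (value_div (value_add (value_reg rfl) (value_reg rfl) (by omega)) (value_const (by omega))
        (by omega)) ?_))
      set mid := (s.reg 8 + s.reg 9) / 2 with hmid
      let M : Fin R.numEdges := ⟨mid, by omega⟩
      have hM : R.hi M = v := (R.mem_out v M).2 ⟨by simp [M]; omega, by simp [M]; omega⟩
      have hval := value_charLt (W := W) (T := T)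
        (s := ⟨Function.update s.reg 10 mid, s.mem⟩) (l := .reg 11) (r := edgeCell 1 (.reg 10))
        (d := R.first M)
        (value_reg rfl) (value_edgeCell (by simpa using h3)
          (value_reg (x := mid) (by simp)) (by omega) (by omega)) h11
        (by rw [hs.labBeg M]; simpa [CdawgRep.first] using R.getElem?_labBeg_add M (R.lab_pos M))
      -- The character sought is the first letter of `g`, so by sortedness the character test
      -- compares edge numbers.
      simp only [R.first_lt_iff _ _ (hg.trans hM.symm)] at hval
      by_cases hgm : g < M
      · rw [if_pos hgm] at hval
        have hgm' : g.val < mid := hgm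
        refine Runs.ite_true hval one_ne_zero (Runs.assign (value_reg rfl) ?_)
        refine Runs.mono (ih _ ?_ (by simpa using h3) (by simpa using h11) (by simpa using h1)
          (by simpa using h2) (by simpa using hgm') (by simp; omega) (by simp; omega)) ?_
        · exact hs
        rintro t s' ⟨ht, hm, h8, hr⟩
        refine ⟨by simp [RExpr.cost, edgeCell]; omega, hm, h8, fun i hi => ?_⟩
        rw [hr i hi]
        simp [show i ≠ 9 by omega, show i ≠ 10 by omega]
      · rw [if_neg hgm] at hval
        have hgm' : mid ≤ g.val := not_lt.1 hgm
        refine Runs.ite_false hval (Runs.assign (value_reg rfl) ?_)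
        refine Runs.mono (ih _ ?_ (by simpa using h3) (by simpa using h11) (by simp; omega)
          (by simpa using hgm') (by simpa using h4) (by simpa using h5) (by simp; omega)) ?_
        · exact hs
        rintro t s' ⟨ht, hm, h8, hr⟩
        refine ⟨by simp [RExpr.cost, edgeCell]; omega, hm, h8, fun i hi => ?_⟩
        rw [hr i hi]
        simp [show i ≠ 8 by omega, show i ≠ 10 by omega]
    · rw [if_neg hlt] at hguard
      exact Runs.loop_false hguard ⟨by simp [RExpr.cost], rfl, by omega, fun i _ => rfl⟩

theorem runs_follow [Fintype A] {e g : Fin R.numEdges} {v : Fin R.numNodes} {k : ℕ}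
    (hW : 8 * R.size + 8 < W) (hs : R.Stored s.mem)
    (h2 : s.reg 2 = e) (h3 : s.reg 3 = 4 + 3 * R.numNodes) (h4 : s.reg 4 = v) (h5 : s.reg 5 = k)
    (hk : k < (R.edge e).lab.length) (hg : R.hi g = v)
    (hgk : (R.edge g).lab.head? = (R.edge e).lab[k]?) :
    Runs W T follow s fun t s' => t ≤ 30 * Nat.clog 2 (Fintype.card A) + 100 ∧ s'.mem = s.mem ∧
      s'.reg 4 = R.lo g ∧ s'.reg 5 = k + (R.edge g).lab.length ∧
      ∀ i < 8, i ≠ 4 → i ≠ 5 → s'.reg i = s.reg i := by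
  have hsize : R.size = T.length + (4 + 3 * R.numNodes + 4 * R.numEdges) := rfl
  have hlab := R.labBeg_add_le e
  have hlabg := R.labBeg_add_le g
  have hout := (R.mem_out v g).1 hg
  have hE := (R.out_le v).2
  have hchar : T[R.labBeg e + k]? = some (R.first g) := by
    rw [R.getElem?_labBeg_add e hk, ← R.head?_lab, hgk, List.getElem?_eq_getElem hk]
  have hb := hs.labBeg e
  refine Runs.seq (Runs.assign (value_add (value_edgeCell h3 (value_reg h2) (by omega) (by omega))
    (value_reg h5) (by omega)) ?_)
  rw [hb]
  refine Runs.seq (Runs.assign (value_nodeCell (value_reg (x := v) (by simpa using h4))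
    (by omega)) ?_)
  refine Runs.seq (Runs.assign (value_nodeCell (value_reg (x := v) (by simpa using h4))
    (by omega)) ?_)
  refine Runs.seq ?_
  simp only [hs.outBeg, hs.outEnd]
  refine Runs.mono (runs_bisect hg hW (Nat.clog 2 (Fintype.card A)) _ ?_ (by simpa using h3)
    (by simpa using hchar) (by simp) (by simpa using hout.1) (by simpa using hout.2) (by simp)
    ?_) ?_
  · exact hs
  · simpa using (R.outDegree_le v).trans (Nat.le_pow_clog one_lt_two _)
  rintro t s' ⟨ht, hm, h8, hr⟩
  have hr2 : ∀ i < 8, s'.reg i = s.reg i := by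
    intro i hi
    rw [hr i hi]
    simp [show i ≠ 8 by omega, show i ≠ 9 by omega, show i ≠ 11 by omega]
  have hs' : R.Stored s'.mem := by rw [hm]; exact hs
  have h3' := (hr2 3 (by omega)).trans h3
  have h5' := (hr2 5 (by omega)).trans h5
  refine Runs.seq (Runs.assign (value_add (value_reg h5')
    (value_sub (value_edgeCell h3' (value_reg h8) (by omega) (by omega))
      (value_edgeCell h3' (value_reg h8) (by omega) (by omega)) ?_) ?_) ?_)
  · rw [hs'.labEnd]; omega
  · rw [hs'.labEnd, hs'.labBeg]; omega
  rw [hs'.labEnd, hs'.labBeg, Nat.add_sub_cancel_left]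
  refine Runs.assign (value_edgeCell (by simpa using h3') (value_reg (x := g) (by simpa using h8))
    (by omega) (by omega)) ⟨?_, hm, ?_, by simp, ?_⟩
  · simp [RExpr.cost, edgeCell, nodeCell]; omega
  · simp [hs'.lo]
  · intro i hi h4 h5
    simp [h4, h5, hr2 i hi]

end Correctness

/-- The source has an outgoing edge for the first letter of `T`. -/
theorem one_le_numExtensions {A : Type u} {T : List A} (hT : T ≠ []) : 1 ≤ numExtensions T := by
  obtain ⟨a, S, rfl⟩ := List.exists_cons_of_ne_nil hT
  obtain ⟨f, hf, -⟩ := exists_edge (T := a :: S) (a := a) rightMaximal_nil ⟨[], S, by simp⟩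
  have := edges_ncard_le (T := a :: S) (s := {f}) (by simpa using hf)
  rw [Finset.card_singleton] at this
  exact this.trans (Nat.le_add_right _ _)

/-! ### Partial output lists. -/

section Lists

variable {A : Type u} [LinearOrder A] {T : List A} (R : CdawgRep T)

/-- The list `L` contains, in order, the type-2 nodes on the edges before the edge `e`, and those
on the edge `e` with an offset less than `k`. -/
def CdawgRep.ListsBelow (L : List (Fin R.numEdges × ℕ × Fin R.numNodes)) (e k : ℕ) : Prop :=
  L.Pairwise (fun x y => x.1 < y.1 ∨ (x.1 = y.1 ∧ x.2.1 < y.2.1)) ∧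
    ∀ e' k' v, (e', k', v) ∈ L ↔ IsType2Node T (R.edge e') k' (R.node v) ∧
      (e'.val < e ∨ (e'.val = e ∧ k' < k))

variable {R} {L : List (Fin R.numEdges × ℕ × Fin R.numNodes)} {e : Fin R.numEdges}
  {v : Fin R.numNodes} {k l : ℕ}

theorem CdawgRep.listsBelow_nil : R.ListsBelow [] 0 0 := by
  simp [ListsBelow]

theorem CdawgRep.ListsBelow.length_le (h : R.ListsBelow L l k) :
    L.length ≤ (leftExtensions T).ncard ∧ L.length ≤ R.numEdges * T.length :=
  R.pairwise_length_le h.1 fun _ hx => ((h.2 _ _ _).1 hx).1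

theorem CdawgRep.ListsBelow.lists (h : R.ListsBelow L R.numEdges 0) : R.ListsType2Nodes L :=
  ⟨h.1, fun e k v => (h.2 e k v).trans (and_iff_left (Or.inl e.isLt))⟩

theorem CdawgRep.ListsBelow.congr {k' l' : ℕ} (h : R.ListsBelow L l k)
    (h' : ∀ e i v, IsType2Node T (R.edge e) i (R.node v) →
      ((e.val < l ∨ (e.val = l ∧ i < k)) ↔ (e.val < l' ∨ (e.val = l' ∧ i < k')))) :
    R.ListsBelow L l' k' :=
  ⟨h.1, fun e i v => (h.2 e i v).trans (and_congr_right (h' e i v))⟩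

theorem CdawgRep.ListsBelow.next_edge (h : R.ListsBelow L e k)
    (hk : (R.edge e).lab.length ≤ k) : R.ListsBelow L (e + 1) 0 := by
  refine h.congr fun e' i v hv => ?_
  have := ((isType2Node_iff (R.edge_mem e')).1 hv).2.1
  constructor
  · omega
  · intro h'
    rcases (by omega : e'.val < e ∨ e'.val = e) with h' | h'
    · exact .inl h'
    · rw [Fin.ext h'] at this
      exact .inr ⟨h', by omega⟩

theorem CdawgRep.ListsBelow.next_offset {k' : ℕ} (h : R.ListsBelow L e k) (hkk : k ≤ k')
    (hk : ∀ i v, k ≤ i → i < k' → ¬ IsType2Node T (R.edge e) i v) : R.ListsBelow L e k' := by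
  refine h.congr fun e' i v hv => or_congr_right (and_congr_right fun he => ?_)
  rw [Fin.ext he] at hv
  refine ⟨fun hi => by omega, fun hi => ?_⟩
  by_contra! hki
  exact hk _ _ hki hi hv

/-- The new triple is last in the order, and it is the only one at its place because the node
reached by the walk is unique. -/
theorem CdawgRep.ListsBelow.snoc (h : R.ListsBelow L e k)
    (hv : IsType2Node T (R.edge e) k (R.node v)) : R.ListsBelow (L ++ [(e, k, v)]) e (k + 1) := by
  constructor
  · refine List.pairwise_append.2 ⟨h.1, List.pairwise_singleton _ _, ?_⟩
    rintro ⟨e', k', v'⟩ hx _ hy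
    obtain rfl := List.mem_singleton.1 hy
    exact ((h.2 _ _ _).1 hx).2.imp id fun h => ⟨Fin.ext h.1, h.2⟩
  · intro e' k' v'
    rw [List.mem_append, h.2, List.mem_singleton]
    constructor
    · rintro (⟨h1, h2⟩ | h)
      · exact ⟨h1, by omega⟩
      · simp only [Prod.mk.injEq] at h
        obtain ⟨rfl, rfl, rfl⟩ := h
        exact ⟨hv, .inr ⟨rfl, by omega⟩⟩
    · rintro ⟨h1, h2⟩
      rcases (by omega : (e'.val < e ∨ (e'.val = e ∧ k' < k)) ∨ (e'.val = e ∧ k' = k)) with h3 | ⟨h3, rfl⟩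
      · exact .inl ⟨h1, h3⟩
      · obtain rfl := Fin.ext h3
        have hw := fun {u} (h : IsType2Node T (R.edge e') k' u) =>
          ((isType2Node_iff (R.edge_mem e')).1 h).2.2
        rw [R.node_injective ((hw h1).unique (R.edge_mem e') (hw hv))]
        exact .inr rfl

end Lists

/-! ### Correctness and amortized cost of the walks. -/

section Correctness

variable {A : Type u} [LinearOrder A] {T : List A} {W : ℕ} {s : Config} {R : CdawgRep T}
  {m : ℕ → ℕ}

theorem runs_emit {L : List (Fin R.numEdges × ℕ × Fin R.numNodes)} {e : Fin R.numEdges}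
    {v : Fin R.numNodes} {k : ℕ} (hW : R.size + 3 * L.length + 8 < W)
    (hm : ∀ a < R.cells, s.mem a = m a) (h0 : s.reg 0 = R.cells) (hL : R.HasOutput s L)
    (h2 : s.reg 2 = e) (h4 : s.reg 4 = v) (h5 : s.reg 5 = k) :
    Runs W T emit s fun t s' => t ≤ 40 ∧ (∀ a < R.cells, s'.mem a = m a) ∧
      R.HasOutput s' (L ++ [(e, k, v)]) ∧ ∀ i ≠ 1, s'.reg i = s.reg i := by
  obtain ⟨h1, hL⟩ := hL
  have hsize : R.size = T.length + R.cells := rfl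
  have haddr : ∀ mem : ℕ → ℕ, (RExpr.op .add (.reg 0) (.op .mul (.const 3) (.reg 1))).value W T
      ⟨s.reg, mem⟩ = some (R.cells + 3 * L.length) := fun mem =>
    value_add (value_reg h0) (value_mul (value_const (by omega)) (value_reg h1) (by omega))
      (by omega)
  refine Runs.seq (Runs.store (haddr _) (value_reg h2) ?_)
  refine Runs.seq (Runs.store (value_add (haddr _) (value_const (by omega)) (by omega))
    (value_reg h5) ?_)
  refine Runs.seq (Runs.store (value_add (haddr _) (value_const (by omega)) (by omega))
    (value_reg h4) ?_)
  refine Runs.assign (value_add (value_reg h1) (value_const (by omega)) (by omega))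
    ⟨by simp [RExpr.cost], fun a ha => ?_, ⟨by simp, fun i hi => ?_⟩, fun i hi => by simp [hi]⟩
  · simp only [Function.update_apply]
    rw [if_neg (by omega), if_neg (by omega), if_neg (by omega), hm a ha]
  · rw [List.length_append, List.length_singleton] at hi
    simp only [Function.update_apply, h0, show (0 : ℕ) ≠ 1 from zero_ne_one, if_false]
    rcases (by omega : i < L.length ∨ i = L.length) with hlt | rfl
    · rw [List.getElem_append_left hlt]
      have := hL i hlt
      rw [h0] at this
      refine ⟨?_, ?_, ?_⟩ <;>
        rw [if_neg (by omega), if_neg (by omega), if_neg (by omega)]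
      exacts [this.1, this.2.1, this.2.2]
    · simp

/-- The state of the computation after the type-2 nodes before offset `k` of edge `e`. -/
structure CdawgRep.Progress (R : CdawgRep T) (m : ℕ → ℕ) (s : Config)
    (L : List (Fin R.numEdges × ℕ × Fin R.numNodes)) (e k : ℕ) : Prop where
  mem : ∀ a < R.cells, s.mem a = m a
  reg_zero : s.reg 0 = R.cells
  reg_two : s.reg 2 = e
  reg_three : s.reg 3 = 4 + 3 * R.numNodes
  output : R.HasOutput s L
  lists : R.ListsBelow L e k

theorem CdawgRep.HasOutput.congr {L : List (Fin R.numEdges × ℕ × Fin R.numNodes)} {s' : Config}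
    (h : R.HasOutput s L) (h0 : s'.reg 0 = s.reg 0) (h1 : s'.reg 1 = s.reg 1)
    (hm : s'.mem = s.mem) : R.HasOutput s' L := by
  unfold CdawgRep.HasOutput at *
  rwa [h0, h1, hm]

theorem CdawgRep.Progress.congr {L : List (Fin R.numEdges × ℕ × Fin R.numNodes)} {s' : Config}
    {e k : ℕ} (h : R.Progress m s L e k) (hr : ∀ i < 4, s'.reg i = s.reg i)
    (hm : s'.mem = s.mem) : R.Progress m s' L e k where
  mem := by rw [hm]; exact h.mem
  reg_zero := (hr 0 (by omega)).trans h.reg_zero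
  reg_two := (hr 2 (by omega)).trans h.reg_two
  reg_three := (hr 3 (by omega)).trans h.reg_three
  output := h.output.congr (hr 0 (by omega)) (hr 1 (by omega)) hm
  lists := h.lists

/-- Every round costs at most the common factor and is paid by the triple it emits; only a round at
offset `0` emits none, hence the `if`. The `4` is the last failing test. The last jump may overshoot
the label, so the final offset is only bounded below and `v` is meaningful only inside the label. -/
theorem runs_walk [Fintype A] {e : Fin R.numEdges} (hm : R.Loaded m)
    (hW : 8 * R.size + 3 * (R.numEdges * T.length) + 8 < W) (n : ℕ) :
    ∀ (s : Config) (L : List (Fin R.numEdges × ℕ × Fin R.numNodes)) (k : ℕ) (v : Fin R.numNodes),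
    (R.edge e).lab.length - k ≤ n → R.Progress m s L e k → s.reg 6 = (R.edge e).lab.length →
    s.reg 4 = v → s.reg 5 = k →
    (k < (R.edge e).lab.length → WalksTo T (R.edge e) k (R.node v)) →
    Runs W T walk s fun t s' => ∃ L', (∃ k', (R.edge e).lab.length ≤ k' ∧ R.Progress m s' L' e k') ∧
      t + (30 * Nat.clog 2 (Fintype.card A) + 150) * L.length ≤
        (30 * Nat.clog 2 (Fintype.card A) + 150) * (L'.length + if k = 0 then 1 else 0) + 4 := by
  have hsize : R.size = T.length + (4 + 3 * R.numNodes + 4 * R.numEdges) := rfl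
  induction n with
  | zero =>
    intro s L k v hn hs h6 h4 h5 hw
    have hguard := value_lt (T := T) (W := W) (value_reg h5) (value_reg h6) (by omega)
    rw [if_neg (by omega)] at hguard
    refine Runs.loop_false hguard ⟨L, ⟨k, by omega, hs⟩, ?_⟩
    simp only [RExpr.cost, mul_add]
    omega
  | succ n ih =>
    intro s L k v hn hs h6 h4 h5 hw
    have hguard := value_lt (T := T) (W := W) (value_reg h5) (value_reg h6) (by omega)
    by_cases hk : k < (R.edge e).lab.length
    swap
    · rw [if_neg hk] at hguard
      refine Runs.loop_false hguard ⟨L, ⟨k, by omega, hs⟩, ?_⟩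
      simp only [RExpr.cost, mul_add]
      omega
    rw [if_pos hk] at hguard
    have hw := hw hk
    obtain ⟨g, hg, hgv, hgk⟩ := hw.exists_edge (R.edge_mem e) hk
    rw [← R.range_edge] at hg
    obtain ⟨g, rfl⟩ := hg
    obtain ⟨hstep, hskip⟩ := hw.step (R.edge_mem e) (R.edge_mem g) hgv hgk
    rw [← R.node_lo] at hstep
    have hpos := R.lab_pos g
    -- The part common to both branches: one jump and the remaining walk. Here `104` is `100` for
    -- the jump plus the final `4`; the tests and `emit` add at most `46`, whence `150`.
    have key : ∀ (s : Config) (L : List (Fin R.numEdges × ℕ × Fin R.numNodes)),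
        R.Progress m s L e (k + 1) → s.reg 6 = (R.edge e).lab.length → s.reg 4 = v →
        s.reg 5 = k → Runs W T follow s fun t s' => Runs W T walk s' fun t' s'' =>
          ∃ L', (∃ k', (R.edge e).lab.length ≤ k' ∧ R.Progress m s'' L' e k') ∧
            t + t' + (30 * Nat.clog 2 (Fintype.card A) + 150) * L.length ≤
              (30 * Nat.clog 2 (Fintype.card A) + 150) * L'.length +
                (30 * Nat.clog 2 (Fintype.card A) + 104) := by
      intro s L hs h6 h4 h5
      refine (runs_follow (by omega) (hm.stored hs.mem) hs.reg_two hs.reg_three h4 h5 hk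
        (R.node_injective ((R.node_hi g).trans hgv)) hgk).mono ?_
      rintro t s' ⟨ht, hmem, h4', h5', hr⟩
      have hlists := hs.lists.next_offset (k' := k + (R.edge g).lab.length) (by omega) (by
        intro i u hi hi' h
        obtain ⟨-, h1, h2⟩ := (isType2Node_iff (R.edge_mem e)).1 h
        exact hskip i _ hi hi' h1 h2)
      have hs' := CdawgRep.Progress.congr { hs with lists := hlists }
        (fun i hi => hr i (by omega) (by omega) (by omega)) hmem
      refine (ih s' L _ (R.lo g) (by omega) hs' ((hr 6 (by omega) (by omega) (by omega)).trans h6)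
        h4' h5' hstep).mono ?_
      rintro t' s'' ⟨L', hL', ht'⟩
      rw [if_neg (by omega), add_zero] at ht'
      exact ⟨L', hL', by omega⟩
    refine Runs.loop_true hguard one_ne_zero (Runs.seq ?_)
    rcases Nat.eq_zero_or_pos k with rfl | hk0
    · have hlists := hs.lists.next_offset (k' := 1) (by omega) (by
        intro i u hi hi' h
        have := ((isType2Node_iff (R.edge_mem e)).1 h).1
        omega)
      refine Runs.ite_false (value_reg h5) (Runs.skip ?_)
      refine (key s L { hs with lists := hlists } h6 h4 h5).mono fun t s' h => h.mono ?_
      rintro t' s'' ⟨L', hL', ht'⟩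
      refine ⟨L', hL', ?_⟩
      simp only [RExpr.cost, if_true, mul_add]
      omega
    · refine Runs.ite_true (value_reg h5) hk0.ne' ?_
      have hL := hs.lists.length_le.2
      refine (runs_emit (by omega) hs.mem hs.reg_zero hs.output hs.reg_two h4 h5).mono ?_
      rintro t₁ s₁ ⟨ht₁, hmem, hout, hr⟩
      have hs₁ : R.Progress m s₁ (L ++ [(e, k, v)]) e (k + 1) :=
        ⟨hmem, (hr 0 (by omega)).trans hs.reg_zero, (hr 2 (by omega)).trans hs.reg_two,
          (hr 3 (by omega)).trans hs.reg_three, hout,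
          hs.lists.snoc ((isType2Node_iff (R.edge_mem e)).2 ⟨hk0, hk, hw⟩)⟩
      refine (key s₁ _ hs₁ ((hr 6 (by omega)).trans h6) ((hr 4 (by omega)).trans h4)
        ((hr 5 (by omega)).trans h5)).mono fun t s' h => h.mono ?_
      rintro t' s'' ⟨L', hL', ht'⟩
      refine ⟨L', hL', ?_⟩
      rw [List.length_append, List.length_singleton, mul_add] at ht'
      simp only [RExpr.cost, if_neg hk0.ne', mul_add]
      omega

theorem runs_startWalk {e : Fin R.numEdges} {L : List (Fin R.numEdges × ℕ × Fin R.numNodes)}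
    (hm : R.Loaded m) (hW : 8 * R.size + 8 < W) (hs : R.Progress m s L e 0) :
    Runs W T startWalk s fun t s' => t ≤ 80 ∧ s'.reg 6 = (R.edge e).lab.length ∧
      ∃ (k : ℕ) (v : Fin R.numNodes), s'.reg 4 = v ∧ s'.reg 5 = k ∧ R.Progress m s' L e k ∧
        WalksTo T (R.edge e) k (R.node v) := by
  have hsize : R.size = T.length + (4 + 3 * R.numNodes + 4 * R.numEdges) := rfl
  have hst := hm.stored hs.mem
  have h2 := hs.reg_two
  have h3 := hs.reg_three
  have hlab := R.labBeg_add_le e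
  refine Runs.seq (Runs.assign (value_sub (value_edgeCell h3 (value_reg h2) (by omega) (by omega))
    (value_edgeCell h3 (value_reg h2) (by omega) (by omega)) ?_) ?_)
  · rw [hst.labEnd]; omega
  refine Runs.seq (Runs.assign (value_edgeCell (by simpa using h3) (value_reg (x := e)
    (by simpa using h2)) (by omega) (by omega)) ?_)
  simp only [hst.labEnd, hst.labBeg, hst.hi, Nat.add_sub_cancel_left]
  have hguard := fun s : Config => value_add (T := T) (W := W) (s := s)
    (value_lt (value_mem (value_const (k := 3) (by omega))) (value_reg (i := 4) rfl) (by omega))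
    (value_lt (value_reg (i := 4) rfl) (value_mem (value_const (k := 3) (by omega))) (by omega))
    (by split_ifs <;> omega)
  by_cases hroot : R.hi e = R.root
  · refine Runs.ite_false ((hguard _).trans ?_) (Runs.assign (value_const (by omega)) ?_)
    · simp [hst.root, hroot]
    have hsource : (R.edge e).hi = source T := by rw [← R.node_hi, hroot, R.node_root]
    refine ⟨by simp [RExpr.cost, edgeCell], by simp, 1, R.root, by simp [hroot], by simp, ?_, ?_⟩
    · have hlists := hs.lists.next_offset (k' := 1) (by omega) (by
        intro i u hi hi' h
        have := ((isType2Node_iff (R.edge_mem e)).1 h).1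
        omega)
      refine CdawgRep.Progress.congr { hs with lists := hlists } (fun i hi => ?_) rfl
      simp [show i ≠ 4 by omega, show i ≠ 5 by omega, show i ≠ 6 by omega]
    · rw [R.node_root]
      exact walksTo_source (R.edge_mem e) hsource
  · refine Runs.ite_true (hguard _) ?_ (Runs.seq (Runs.assign
      (value_nodeCell (value_reg (x := R.hi e) (by simp)) (by omega))
      (Runs.assign (value_const (by omega)) ?_)))
    · simp only [hst.root, Function.update_self]
      have : (R.hi e).val ≠ R.root := fun h => hroot (Fin.ext h)
      split_ifs <;> omega
    refine ⟨by simp [RExpr.cost, edgeCell, nodeCell], by simp, 0, R.slink (R.hi e),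
      by simpa using hst.slink (R.hi e), by simp, ?_, ?_⟩
    · refine hs.congr (fun i hi => ?_) rfl
      simp [show i ≠ 4 by omega, show i ≠ 5 by omega, show i ≠ 6 by omega]
    · refine walksTo_suffixLink (R.node_mem _) ?_
      rw [← R.node_hi]
      exact R.slink_spec _ hroot

/-- Each edge is granted the factor twice: once for a possible round at offset `0`, once for
`startWalk` and the loop overhead. -/
theorem runs_allWalks [Fintype A] (hm : R.Loaded m)
    (hW : 8 * R.size + 3 * (R.numEdges * T.length) + 8 < W) (n : ℕ) :
    ∀ (s : Config) (L : List (Fin R.numEdges × ℕ × Fin R.numNodes)) (e : ℕ),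
    e + n = R.numEdges → R.Progress m s L e 0 →
    Runs W T allWalks s fun t s' => ∃ L', R.Progress m s' L' R.numEdges 0 ∧
      t + (30 * Nat.clog 2 (Fintype.card A) + 150) * L.length ≤
        (30 * Nat.clog 2 (Fintype.card A) + 150) * (L'.length + 2 * n) + 10 := by
  have hsize : R.size = T.length + (4 + 3 * R.numNodes + 4 * R.numEdges) := rfl
  induction n with
  | zero =>
    rintro s L _ rfl hs
    have hguard := value_lt (T := T) (W := W) (value_reg hs.reg_two)
      (value_mem (value_const (k := 2) (by omega))) (by omega)
    rw [(hm.stored hs.mem).numEdges, if_neg (by omega)] at hguard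
    refine Runs.loop_false hguard ⟨L, hs, ?_⟩
    simp only [RExpr.cost, mul_add]
    omega
  | succ n ih =>
    intro s L e he hs
    have hguard := value_lt (T := T) (W := W) (value_reg hs.reg_two)
      (value_mem (value_const (k := 2) (by omega))) (by omega)
    rw [(hm.stored hs.mem).numEdges, if_pos (by omega)] at hguard
    obtain ⟨e, rfl⟩ : ∃ e' : Fin R.numEdges, e'.val = e := ⟨⟨e, by omega⟩, rfl⟩
    refine Runs.loop_true hguard one_ne_zero (Runs.seq ?_)
    refine (runs_startWalk hm (by omega) hs).mono ?_
    rintro t₁ s₁ ⟨ht₁, h6, k, v, h4, h5, hs₁, hw⟩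
    set D := 30 * Nat.clog 2 (Fintype.card A) + 150 with hD
    have hD' : 150 ≤ D := Nat.le_add_left _ _
    refine Runs.seq ?_
    refine (runs_walk hm hW _ s₁ L k v le_rfl hs₁ h6 h4 h5 fun _ => hw).mono ?_
    rintro t₂ s₂ ⟨L₂, ⟨k', hk', hs₂⟩, ht₂⟩
    refine Runs.assign (value_add (value_reg hs₂.reg_two) (value_const (by omega)) (by omega)) ?_
    refine (ih _ L₂ (e + 1) (by omega) ?_).mono ?_
    · exact ⟨hs₂.mem, by simpa using hs₂.reg_zero, by simp, by simpa using hs₂.reg_three,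
        hs₂.output.congr (by simp) (by simp) rfl, hs₂.lists.next_edge hk'⟩
    · rintro t₃ s₃ ⟨L₃, hs₃, ht₃⟩
      refine ⟨L₃, hs₃, ?_⟩
      rw [← hD] at ht₂
      simp only [RExpr.cost]
      split_ifs at ht₂ <;> linarith

theorem runs_type2Program [Fintype A] (hm : R.Loaded m)
    (hW : 8 * R.size + 3 * (R.numEdges * T.length) + 8 < W) :
    Runs W T type2Program ⟨fun _ => 0, m⟩ fun t s => ∃ L, R.Progress m s L R.numEdges 0 ∧
      t ≤ (30 * Nat.clog 2 (Fintype.card A) + 150) * (L.length + 2 * R.numEdges) + 50 := by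
  have hsize : R.size = T.length + (4 + 3 * R.numNodes + 4 * R.numEdges) := rfl
  have h1 := hm.numNodes
  have h2 := hm.numEdges
  refine Runs.seq (Runs.assign (value_add (value_const (by omega)) (value_mul
    (value_const (by omega)) (value_mem (value_const (by omega))) ?_) ?_) ?_)
  · simp only [h1]; omega
  · simp only [h1]; omega
  refine Runs.seq (Runs.assign (value_add (value_reg rfl) (value_mul
    (value_const (by omega)) (value_mem (value_const (by omega))) ?_) ?_) ?_)
  · simp [h2]; omega
  · simp [h1, h2]; omega
  refine (runs_allWalks hm hW R.numEdges _ [] 0 (zero_add _) ?_).mono ?_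
  · exact ⟨fun _ _ => rfl, by simp [h1, h2, CdawgRep.cells], by simp, by simp [h1],
      ⟨by simp, by simp⟩, CdawgRep.listsBelow_nil⟩
  · rintro t s ⟨L, hL, ht⟩
    refine ⟨L, hL, ?_⟩
    simp [RExpr.cost] at ht ⊢
    omega

end Correctness

end LCDAWG

theorem mainTheorem7 :
    ∃ (p : LCDAWG.Prog) (c : ℕ) (C : ℝ),
      ∀ (A : Type*) [LinearOrder A] [Fintype A], 2 ≤ Fintype.card A →
      ∀ T : List A, LCDAWG.EndMarked T →
      ∀ (R : LCDAWG.CdawgRep T) (m : ℕ → ℕ), R.Loaded m →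
      ∀ W : ℕ, R.size ^ c ≤ W →
      ∃ (t : ℕ) (s : LCDAWG.Config) (L : List (Fin R.numEdges × ℕ × Fin R.numNodes)),
        LCDAWG.Exec W T p ⟨fun _ => 0, m⟩ t s ∧
        (t : ℝ) ≤ C * LCDAWG.numExtensions T * Real.logb 2 (Fintype.card A) ∧
        R.ListsType2Nodes L ∧ R.HasOutput s L ∧
        ∀ a < R.cells, s.mem a = m a := by
  -- Addresses are at most quadratic in the input size, which is at least `7`; the fourth power
  -- absorbs the constants.
  refine ⟨LCDAWG.type2Program, 4, 1000, ?_⟩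
  intro A _ _ hA T hT R m hm W hW
  have hN : R.size = T.length + (4 + 3 * R.numNodes + 4 * R.numEdges) := rfl
  have hroot : 0 < R.numNodes := R.root.pos
  have hmul : R.numEdges * T.length ≤ R.size * R.size :=
    Nat.mul_le_mul (by omega) (by omega)
  have hW' : 8 * R.size + 3 * (R.numEdges * T.length) + 8 < W := by
    refine lt_of_lt_of_le ?_ hW
    have h7 : 7 ≤ R.size := by omega
    have : R.size ^ 4 = R.size * R.size * (R.size * R.size) := by ring
    nlinarith [Nat.mul_le_mul h7 h7]
  obtain ⟨t, s, hexec, L, hL, ht⟩ := LCDAWG.runs_type2Program hm hW'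
  refine ⟨t, s, L, hexec, ?_, hL.lists.lists, hL.output, hL.mem⟩
  have hlog : 1 ≤ Real.logb 2 (Fintype.card A) := by
    rw [Real.le_logb_iff_rpow_le one_lt_two (by positivity)]
    simpa using hA
  -- Rounding up adds less than `1`, and the logarithm is at least `1` since there are two letters.
  have hclog : (Nat.clog 2 (Fintype.card A) : ℝ) ≤ 2 * Real.logb 2 (Fintype.card A) := by
    have h1 := Real.natCeil_logb_natCast 2 (Fintype.card A)
    have h2 := Nat.ceil_lt_add_one (zero_le_one.trans hlog)
    rw [← h1]
    push_cast at h2 ⊢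
    linarith
  have hcount : L.length + R.numEdges ≤ LCDAWG.numExtensions T := by
    rw [LCDAWG.numExtensions, add_comm]
    exact Nat.add_le_add R.numEdges_le hL.lists.length_le.1
  -- This absorbs the additive constant `50` of the running time.
  have hone : 1 ≤ LCDAWG.numExtensions T := by
    obtain ⟨S, d, rfl, -⟩ := hT
    exact LCDAWG.one_le_numExtensions (by simp)
  have ht' : t ≤ (60 * Nat.clog 2 (Fintype.card A) + 350) * LCDAWG.numExtensions T := by
    have := Nat.mul_le_mul_left (30 * Nat.clog 2 (Fintype.card A) + 150)
      (show L.length + 2 * R.numEdges ≤ 2 * LCDAWG.numExtensions T by omega)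
    linarith
  calc (t : ℝ) ≤ (60 * Nat.clog 2 (Fintype.card A) + 350) * LCDAWG.numExtensions T := by
        exact_mod_cast ht'
    _ ≤ (1000 * Real.logb 2 (Fintype.card A)) * LCDAWG.numExtensions T := by
        refine mul_le_mul_of_nonneg_right ?_ (Nat.cast_nonneg _)
        linarith
    _ = _ := by ring
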